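/- **Asymptotic variance of the nonparametric estimator.** Let $T\in\{0,1\}$ be a treatment, $X$ a vector of pre-treatment covariates with values in $\mathcal X$, $M(t)\in\{0,\dots,J-1\}$ ($t=0,1$) the potential mediators, and $Y(t,m)\in\mathbb R$ the potential outcomes of a unit; the observed mediator and outcome are $M=M(T)$ and $Y=Y(T,M(T))$, and $\mathrm E(Y^2)<\infty$. Assume sequential ignorability: for all $t,t'\in\{0,1\}$ and all $m$, $$\{Y(t',m),M(t)\}\perp T\mid X,\qquad Y(t',m)\perp M(t)\mid T=t,\,X,$$ and, for almost every value $x$ of $X$, $\Pr(T=t\mid X=x)>0$ and $\Pr(M(t)=m\mid T=t,X=x)>0$. Let $(T_i,X_i,M_i(\cdot),Y_i(\cdot,\cdot))$, $i=1,2,\dots$, be i.i.d. copies, $n_t=\sum_{i=1}^n \mathbf 1\{T_i=t\}$, and for $t=0,1$ let $$\hat\delta(t)=\hat\delta_n(t)=\sum_{m=0}^{J-1}\frac{\sum_{i=1}^n Y_i\mathbf 1\{T_i=t,M_i=m\}}{\sum_{i=1}^n \mathbf 1\{T_i=t,M_i=m\}}\Bigl(\frac1{n_1}\sum_{i=1}^n\mathbf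 1\{T_i=1,M_i=m\}-\frac1{n_0}\sum_{i=1}^n\mathbf 1\{T_i=0,M_i=m\}\Bigr)$$ (a ratio with denominator $0$ is read as $0$). Put $\nu_{tm}=\Pr(M=m\mid T=t)$, $\mu_{tm}=\mathrm E(Y\mid M=m,T=t)$, $\delta^*(t)=\sum_{m}\mu_{tm}(\nu_{1m}-\nu_{0m})$ and, for $a,b>0$, $$V_t(a,b)=\frac1a\sum_{m=0}^{J-1}\nu_{1-t,m}\Bigl\{\Bigl(\frac{\nu_{1-t,m}}{\nu_{tm}}-2\Bigr)\operatorname{Var}(Y\mid M=m,T=t)+\frac{a(1-\nu_{1-t,m})\mu_{tm}^2}{b}\Bigr\}-\frac2b\sum_{m=0}^{J-2}\sum_{m'=m+1}^{J-1}\nu_{1-t,m}\nu_{1-t,m'}\mu_{tm}\mu_{tm'}+\frac1a\operatorname{Var}(Y\mid T=t).$$ Then, given the realized values of the treatment, the asymptotic variance of $\hat\delta(t)$ is $V_t(n_t,n_{1-t})$. Precisely, for $t=0,1$: 1. $\Pr(T=s)>0$ for $s=0,1$, and almost surely $n_s/n\to\Pr(T=s)$ for $s=0,1$. 2. Let $\tau_1,\tau_2,\dots\in\{0,1\}$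 be any treatment sequence for which $n_s/n\to q_s>0$ for $s=0,1$. Then, for every $n$, the event $T_1=\tau_1,\dots,T_n=\tau_n$ has positive probability and, conditionally on it, $\hat\delta_n(t)$ has a finite second moment; as $n\to\infty$, $$n\bigl\{\operatorname{Var}(\hat\delta_n(t)\mid T_1=\tau_1,\dots,T_n=\tau_n)-V_t(n_t,n_{1-t})\bigr\}\to0,\qquad n\,V_t(n_t,n_{1-t})\to V_t(q_t,q_{1-t})\ge0,$$ the ratio of the conditional variance to $V_t(n_t,n_{1-t})$ tends to $1$ if $V_t(q_t,q_{1-t})>0$, and the conditional law of $\sqrt n\,(\hat\delta_n(t)-\delta^*(t))$ converges weakly to $N(0,V_t(q_t,q_{1-t}))$ (the point mass at $0$ if this variance is $0$). 3. If the population is a single covariate stratum, that is, if $X$ is almost surely constant, then $Y(t,M(1))-Y(t,M(0))$ is integrable and $\delta^*(t)$ is the average causal mediation effect $\mathrm E\{Y(t,M(1))-Y(t,M(0))\}$. -/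

import Mathlib

open MeasureTheory ProbabilityTheory Filter Topology

noncomputable section

namespace Mediation

/-- Everything attached to one unit: the treatment `T ∈ {0, 1}`, the pre-treatment covariates
`X ∈ 𝒳`, the potential mediators `t ↦ M(t) ∈ {0, …, J-1}` and the potential outcomes
`t, m ↦ Y(t, m) ∈ ℝ`. -/
abbrev UnitData (J : ℕ) (𝒳 : Type*) : Type _ :=
  Fin 2 × 𝒳 × (Fin 2 → Fin J) × (Fin 2 → Fin J → ℝ)

variable {J : ℕ} {𝒳 : Type*}

/-- The treatment `T`. -/
def treat (u : UnitData J 𝒳) : Fin 2 := u.1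

/-- The covariates `X`. -/
def covar (u : UnitData J 𝒳) : 𝒳 := u.2.1

/-- The potential mediator `M(t)`. -/
def potMed (t : Fin 2) (u : UnitData J 𝒳) : Fin J := u.2.2.1 t

/-- The potential outcome `Y(t, m)`. -/
def potOut (t : Fin 2) (m : Fin J) (u : UnitData J 𝒳) : ℝ := u.2.2.2 t m

/-- The observed mediator `M = M(T)`. -/
def obsMed (u : UnitData J 𝒳) : Fin J := potMed (treat u) u

/-- The observed outcome `Y = Y(T, M(T))`. -/
def obsOut (u : UnitData J 𝒳) : ℝ := potOut (treat u) (obsMed u) u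

section Population

variable [MeasurableSpace 𝒳]

lemma measurable_covar : Measurable (covar : UnitData J 𝒳 → 𝒳) :=
  measurable_fst.comp measurable_snd

/-- The σ-algebra generated by the covariates. -/
abbrev covarSigma (J : ℕ) (𝒳 : Type*) [MeasurableSpace 𝒳] : MeasurableSpace (UnitData J 𝒳) :=
  MeasurableSpace.comap covar inferInstance

lemma covarSigma_le : covarSigma J 𝒳 ≤ (inferInstance : MeasurableSpace (UnitData J 𝒳)) :=
  measurable_covar.comap_le

/-- Sequential ignorability of the population law `Q` of one unit. -/
structure SequentialIgnorability [StandardBorelSpace 𝒳] (Q : Measure (UnitData J 𝒳))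
    [IsProbabilityMeasure Q] : Prop where
  /-- `{Y(t', m), M(t)} ⫫ T | X`. -/
  treatment : ∀ (t t' : Fin 2) (m : Fin J),
    CondIndepFun (covarSigma J 𝒳) covarSigma_le (fun u => (potOut t' m u, potMed t u)) treat Q
  /-- `Y(t', m) ⫫ M(t) | T = t, X`. -/
  mediator : ∀ (t t' : Fin 2) (m : Fin J),
    CondIndepFun (covarSigma J 𝒳) covarSigma_le (potOut t' m) (potMed t)
      (cond Q {u | treat u = t})
  /-- `0 < Pr(T = t | X)`. -/
  treatment_pos : ∀ t : Fin 2, ∀ᵐ u ∂Q, 0 < (Q⟦{u | treat u = t} | covarSigma J 𝒳⟧) u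
  /-- `0 < Pr(M(t) = m | T = t, X)`. -/
  mediator_pos : ∀ (t : Fin 2) (m : Fin J), ∀ᵐ u ∂(cond Q {u | treat u = t}),
    0 < ((cond Q {u | treat u = t})⟦{u | potMed t u = m} | covarSigma J 𝒳⟧) u

/-- `ν_{tm} = Pr(M = m | T = t)`. -/
def nu (Q : Measure (UnitData J 𝒳)) (t : Fin 2) (m : Fin J) : ℝ :=
  (cond Q {u | treat u = t}).real {u | obsMed u = m}

/-- `μ_{tm} = E(Y | M = m, T = t)`. -/
def mu (Q : Measure (UnitData J 𝒳)) (t : Fin 2) (m : Fin J) : ℝ :=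
  ∫ u, obsOut u ∂(cond Q {u | obsMed u = m ∧ treat u = t})

/-- `Var(Y | M = m, T = t)`. -/
def cellVar (Q : Measure (UnitData J 𝒳)) (t : Fin 2) (m : Fin J) : ℝ :=
  variance obsOut (cond Q {u | obsMed u = m ∧ treat u = t})

/-- `Var(Y | T = t)`. -/
def armVar (Q : Measure (UnitData J 𝒳)) (t : Fin 2) : ℝ :=
  variance obsOut (cond Q {u | treat u = t})

/-- The variance formula, as a function of `a` (in the role of `n_t`) and `b` (in the role of
`n_{1-t}`). -/
def varFormula (Q : Measure (UnitData J 𝒳)) (t : Fin 2) (a b : ℝ) : ℝ :=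
  1 / a * ∑ m : Fin J, nu Q (1 - t) m *
      ((nu Q (1 - t) m / nu Q t m - 2) * cellVar Q t m
        + a * (1 - nu Q (1 - t) m) * mu Q t m ^ 2 / b)
    - 2 / b * ∑ m : Fin J, ∑ m' ∈ Finset.Ioi m,
        nu Q (1 - t) m * nu Q (1 - t) m' * mu Q t m * mu Q t m'
    + 1 / a * armVar Q t

/-- The population analogue of the estimator, `∑ₘ μ_{tm} (ν_{1m} - ν_{0m})`. -/
def estimand (Q : Measure (UnitData J 𝒳)) (t : Fin 2) : ℝ :=
  ∑ m : Fin J, mu Q t m * (nu Q 1 m - nu Q 0 m)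

/-- The individual causal mediation effect `δ(t) = Y(t, M(1)) - Y(t, M(0))`. -/
def mediationEffect (t : Fin 2) (u : UnitData J 𝒳) : ℝ :=
  potOut t (potMed 1 u) u - potOut t (potMed 0 u) u

end Population

section Sample

/-- `n_t`, the number of the units `0, …, n-1` with treatment `t`, for a treatment
sequence `τ`. -/
def groupSize (τ : ℕ → Fin 2) (n : ℕ) (t : Fin 2) : ℝ :=
  ∑ i ∈ Finset.range n, if τ i = t then 1 else 0

/-- The number of the units `0, …, n-1` with `T = t` and `M = m`. -/
def cellSize (u : ℕ → UnitData J 𝒳) (n : ℕ) (t : Fin 2) (m : Fin J) : ℝ :=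
  ∑ i ∈ Finset.range n, if treat (u i) = t ∧ obsMed (u i) = m then 1 else 0

/-- The sum of the outcomes of the units `0, …, n-1` with `T = t` and `M = m`. -/
def cellSum (u : ℕ → UnitData J 𝒳) (n : ℕ) (t : Fin 2) (m : Fin J) : ℝ :=
  ∑ i ∈ Finset.range n, if treat (u i) = t ∧ obsMed (u i) = m then obsOut (u i) else 0

/-- The plug-in estimator `δ̂(t)` computed from the units `0, …, n-1`; the mean outcome of an
empty cell is read as `0`. -/
def deltaHat (u : ℕ → UnitData J 𝒳) (n : ℕ) (t : Fin 2) : ℝ :=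
  ∑ m : Fin J, cellSum u n t m / cellSize u n t m *
    (1 / groupSize (fun i => treat (u i)) n 1 * cellSize u n 1 m
      - 1 / groupSize (fun i => treat (u i)) n 0 * cellSize u n 0 m)

/-- The conditional law given that the first `n` treatments take the values `τ 0, …, τ (n-1)`. -/
def condTreat {Ω : Type*} [MeasurableSpace Ω] (P : Measure Ω) (U : ℕ → Ω → UnitData J 𝒳)
    (τ : ℕ → Fin 2) (n : ℕ) : Measure Ω :=
  cond P {ω | ∀ i < n, treat (U i ω) = τ i}

end Sample

end Mediation

end

/-!
Let `s = 1 - t`. Up to a sign, the estimator is `∑ₘ Ȳₘ (pₘ - pₘ')`, where `Ȳₘ` is the mean outcome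
of the cell `M = m` in arm `t`, and `pₘ`, `pₘ'` are the shares of this cell in the arms `t`, `s`.

*Reduction to two independent samples.* Given `T₁ = τ₁, …, Tₙ = τₙ`, the units are independent, and
the `i`-th one has the law of a unit with treatment `τᵢ` (`identDistrib_deltaHat`). Hence all
conditional statements are statements about one fixed infinite product measure, `sampleLaw`, under
which each arm is an i.i.d. sequence (`IsArmSample`).

*Linearization.* Write `μₘ` and `σₘ²` for the mean and the variance of `Y` in the cell `m` of arm `t`.
Let `Zₘ` be the average over arm `t` of `1{M = m} (Y - μₘ)`, and let `rₘ = ν_{sm} / ν_{tm}`. The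
contribution of the cell `m` differs from the linear expression
`(1 - rₘ) Zₘ + μₘ (pₘ - pₘ')` by `Zₘ (rₘ - pₘ' / pₘ)` if the cell is not empty in arm `t`, and by
`μₘ pₘ'` if it is. To show that the error is `o(n^{-1/2})` in `L²` with only two moments of `Y`, one conditions on
the mediators of all units: given these, `pₘ` and `pₘ'` are fixed, while the residuals are
uncorrelated with variance `σₘ²` (`integral_sq_sum_mul`), so that the expectation of
`Zₘ² (pₘ' / pₘ - rₘ)²` is `σₘ² / n_t` times that of `pₘ (pₘ' / pₘ - rₘ)²`. The latter tends to `0`: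
where `pₘ` is at least half of its expectation, the errors of the shares bound it, and elsewhere
it is `O(n)`, on an event of exponentially small probability by Hoeffding's inequality
(`share_mul_sq_ratio_le`, `measure_cell_share_lt_le`).

*Conclusion.* The linear part is a difference of averages over the two independent arms. The two
influence functions `influenceSelf` and `influenceOther` have variances whose combination is the
variance formula (`varFormula_eq`, a decomposition of variances within and between cells). Both the
variance (`tendsto_mul_variance`) and the central limit theorem
(`tendstoInDistribution_of_remainder`) survive an `L²` error of order `o(n^{-1/2})`.

*One stratum.* If the covariates are constant, sequential ignorability becomes unconditional
independence, and `E Y(t, M(r)) = ∑ₘ E Y(t, m) Pr(M(r) = m) = ∑ₘ μ_{tm} ν_{rm}`.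
-/

namespace Mediation

/-! ### Conditional orthogonality given the classes -/

section Replacement

variable {ι K S Ω : Type*} [MeasurableSpace K] [MeasurableSingletonClass K] [MeasurableSpace S]
  [MeasurableSpace Ω] {P : Measure Ω} {X : ι → Ω → S} {c : S → K}

lemma integrable_mul_comp_class [Fintype ι] [DecidableEq ι] [Fintype K]
    (hX : ∀ i, Measurable (X i)) (hc : Measurable c) (G : (ι → K) → ℝ)
    {F : Ω → ℝ} (hF : Integrable F P) :
    Integrable (fun ω => F ω * G (fun i => c (X i ω))) P := by
  have hGm : Measurable (fun ω => G (fun i => c (X i ω))) :=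
    (measurable_of_finite G).comp (measurable_pi_lambda _ fun i => hc.comp (hX i))
  exact hF.mul_bdd (c := ∑ v, ‖G v‖) hGm.aestronglyMeasurable
    (ae_of_all _ fun ω => Finset.single_le_sum (f := fun v => ‖G v‖)
      (fun _ _ => norm_nonneg _) (Finset.mem_univ _))

variable [DecidableEq K]

lemma measurable_class_ite (hc : Measurable c) {f : S → ℝ} (hf : Measurable f) (k : K) :
    Measurable (fun s => if c s = k then f s else 0) :=
  Measurable.ite (hc (measurableSet_singleton k)) hf measurable_const

lemma integrable_class_ite (hX : ∀ i, Measurable (X i)) (hc : Measurable c) {f : S → ℝ} {i : ι}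
    (hfi : Integrable (fun ω => f (X i ω)) P) (k : K) :
    Integrable (fun ω => if c (X i ω) = k then f (X i ω) else 0) P := by
  have := hfi.indicator ((hc.comp (hX i)) (measurableSet_singleton k))
  refine this.congr (ae_of_all _ fun ω => ?_)
  by_cases h : c (X i ω) = k <;> simp [h]

variable [Fintype ι] [DecidableEq ι] [Fintype K] [IsProbabilityMeasure P]

/-- In the expectation of `G (c ∘ X) * ∏ i, f i (X i)`, where `G` depends on the `X i` only through
their classes `c (X i)`, each factor may be replaced by another one with the same conditional mean
given the class. For both sides are sums over the finitely many vectors of classes, and for a fixed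
vector the expectation factors by independence. -/
lemma integral_mul_prod_congr (hX : ∀ i, Measurable (X i)) (hind : iIndepFun X P)
    (hc : Measurable c) {f g : ι → S → ℝ} (hf : ∀ i, Measurable (f i)) (hg : ∀ i, Measurable (g i))
    (hfi : ∀ i, Integrable (fun ω => f i (X i ω)) P)
    (hgi : ∀ i, Integrable (fun ω => g i (X i ω)) P)
    (h : ∀ i k, ∫ ω, (if c (X i ω) = k then f i (X i ω) else 0) ∂P
      = ∫ ω, (if c (X i ω) = k then g i (X i ω) else 0) ∂P)
    (G : (ι → K) → ℝ) :
    ∫ ω, G (fun i => c (X i ω)) * ∏ i, f i (X i ω) ∂P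
      = ∫ ω, G (fun i => c (X i ω)) * ∏ i, g i (X i ω) ∂P := by
  have key : ∀ f : ι → S → ℝ, (∀ i, Measurable (f i)) →
      (∀ i, Integrable (fun ω => f i (X i ω)) P) →
      ∫ ω, G (fun i => c (X i ω)) * ∏ i, f i (X i ω) ∂P
        = ∑ v : ι → K, G v * ∏ i, ∫ ω, (if c (X i ω) = v i then f i (X i ω) else 0) ∂P := by
    intro f hf hfi
    have hexp : ∀ ω, G (fun i => c (X i ω)) * ∏ i, f i (X i ω)
        = ∑ v : ι → K, G v * ∏ i, (if c (X i ω) = v i then f i (X i ω) else 0) := by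
      intro ω
      rw [Finset.sum_eq_single (fun i => c (X i ω))]
      · simp
      · intro v _ hv
        obtain ⟨i, hi⟩ := Function.ne_iff.mp hv
        rw [Finset.prod_eq_zero (Finset.mem_univ i) (if_neg (Ne.symm hi)), mul_zero]
      · simp
    simp_rw [hexp]
    rw [integral_finsetSum]
    · refine Finset.sum_congr rfl fun v _ => ?_
      rw [integral_const_mul]
      congr 1
      exact hind.integral_fun_prod_comp (f := fun i s => if c s = v i then f i s else 0)
        (fun i => (hX i).aemeasurable)
        fun i => (measurable_class_ite hc (hf i) (v i)).aestronglyMeasurable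
    · intro v _
      refine Integrable.const_mul ?_ _
      have hpi := hind.map_fun_eq_pi_map (fun i => (hX i).aemeasurable)
      have hint : Integrable (fun x : ι → S => ∏ i, (if c (x i) = v i then f i (x i) else 0))
          (P.map (fun ω i => X i ω)) := by
        rw [hpi]
        have : ∀ i, IsProbabilityMeasure (P.map (X i)) :=
          fun i => Measure.isProbabilityMeasure_map (hX i).aemeasurable
        refine Integrable.fintype_prod (f := fun i s => if c s = v i then f i s else 0) fun i => ?_
        rw [integrable_map_measure
          (measurable_class_ite hc (hf i) (v i)).aestronglyMeasurable (hX i).aemeasurable]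
        exact integrable_class_ite hX hc (hfi i) (v i)
      exact hint.comp_measurable (measurable_pi_lambda _ hX)
  rw [key f hf hfi, key g hg hgi]
  simp_rw [h]

/-- If, given the classes `c (X i)`, the variables `ξ (X i)` are centred with second moment
`ζ (X i)`, then they are conditionally uncorrelated: the square of their sum may be replaced by the
sum of the `ζ (X i)` in the expectation against any function `G` of the classes. -/
lemma integral_sq_sum_mul (hX : ∀ i, Measurable (X i)) (hind : iIndepFun X P)
    (hc : Measurable c) {ξ ζ : S → ℝ} (hξ : Measurable ξ) (hζ : Measurable ζ) {s : Finset ι}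
    (hξi : ∀ i ∈ s, MemLp (fun ω => ξ (X i ω)) 2 P)
    (hζi : ∀ i ∈ s, Integrable (fun ω => ζ (X i ω)) P)
    (h0 : ∀ i ∈ s, ∀ k, ∫ ω, (if c (X i ω) = k then ξ (X i ω) else 0) ∂P = 0)
    (h1 : ∀ i ∈ s, ∀ k, ∫ ω, (if c (X i ω) = k then ξ (X i ω) ^ 2 else 0) ∂P
      = ∫ ω, (if c (X i ω) = k then ζ (X i ω) else 0) ∂P)
    (G : (ι → K) → ℝ) :
    ∫ ω, (∑ i ∈ s, ξ (X i ω)) ^ 2 * G (fun i => c (X i ω)) ∂P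
      = ∫ ω, (∑ i ∈ s, ζ (X i ω)) * G (fun i => c (X i ω)) ∂P := by
  have hGb : ∀ F : Ω → ℝ, Integrable F P → Integrable (fun ω => F ω * G (fun i => c (X i ω))) P :=
    fun F hF => integrable_mul_comp_class hX hc G hF
  have hpair : ∀ i ∈ s, ∀ j ∈ s,
      ∫ ω, ξ (X i ω) * ξ (X j ω) * G (fun i => c (X i ω)) ∂P
        = if i = j then ∫ ω, ζ (X i ω) * G (fun i => c (X i ω)) ∂P else 0 := by
    intro i hi j hj
    split_ifs with hij
    -- for `i = j` the factor `ξ (X i) ^ 2` may be replaced by `ζ (X i)`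
    · subst hij
      have := integral_mul_prod_congr hX hind hc
        (f := fun l x => if l = i then ξ x ^ 2 else 1) (g := fun l x => if l = i then ζ x else 1)
        (fun l => by split_ifs <;> fun_prop) (fun l => by split_ifs <;> fun_prop)
        (fun l => by
          by_cases hl : l = i
          · subst hl; simpa using (hξi _ hi).integrable_sq
          · simp [hl])
        (fun l => by
          by_cases hl : l = i
          · subst hl; simpa using hζi _ hi
          · simp [hl])
        (fun l k => by
          by_cases hl : l = i
          · subst hl; simpa using h1 _ hi k
          · simp [hl]) G
      simp only [Finset.prod_ite_eq', Finset.mem_univ, if_true] at this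
      simpa only [mul_comm, pow_two] using this
    -- for `i ≠ j` the factors `ξ (X i)` and `ξ (X j)` may be replaced by `0`
    · have := integral_mul_prod_congr hX hind hc
        (f := fun l x => if l = i ∨ l = j then ξ x else 1)
        (g := fun l x => if l = i ∨ l = j then 0 else 1)
        (fun l => by split_ifs <;> fun_prop) (fun l => by split_ifs <;> fun_prop)
        (fun l => by
          by_cases hl : l = i ∨ l = j
          · simp only [hl, if_true]
            refine (hξi l ?_).integrable one_le_two
            rcases hl with rfl | rfl <;> assumption
          · simp [hl])
        (fun l => by
          by_cases hl : l = i ∨ l = j <;> simp [hl])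
        (fun l k => by
          by_cases hl : l = i ∨ l = j
          · simp only [hl, if_true, ite_self, integral_zero]
            refine h0 l ?_ k
            rcases hl with rfl | rfl <;> assumption
          · simp [hl]) G
      have hz : ∀ ω : Ω, (∏ l, (if l = i ∨ l = j then (0 : ℝ) else 1)) = 0 :=
        fun _ => Finset.prod_eq_zero (Finset.mem_univ i) (by simp)
      have hp : ∀ ω, (∏ l, (if l = i ∨ l = j then ξ (X l ω) else 1)) = ξ (X i ω) * ξ (X j ω) := by
        intro ω
        rw [← Finset.prod_filter]
        have : Finset.univ.filter (fun l => l = i ∨ l = j) = {i, j} := by ext; simp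
        rw [this, Finset.prod_pair hij]
      simp only [hp] at this
      rw [integral_congr_ae (ae_of_all _ fun ω => mul_comm _ _), this]
      simp [Finset.prod_eq_zero (Finset.mem_univ i)]
  have hint : ∀ i ∈ s, ∀ j ∈ s,
      Integrable (fun ω => ξ (X i ω) * ξ (X j ω) * G (fun i => c (X i ω))) P :=
    fun i hi j hj => hGb _ ((hξi i hi).integrable_mul (hξi j hj))
  calc ∫ ω, (∑ i ∈ s, ξ (X i ω)) ^ 2 * G (fun i => c (X i ω)) ∂P
      = ∫ ω, ∑ i ∈ s, ∑ j ∈ s, ξ (X i ω) * ξ (X j ω) * G (fun i => c (X i ω)) ∂P := by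
        refine integral_congr_ae (ae_of_all _ fun ω => ?_)
        simp only [pow_two (∑ i ∈ s, ξ (X i ω))]
        rw [Finset.sum_mul_sum]
        simp only [Finset.sum_mul]
    _ = ∑ i ∈ s, ∫ ω, ζ (X i ω) * G (fun i => c (X i ω)) ∂P := by
        rw [integral_finsetSum _ fun i hi => integrable_finsetSum _ fun j hj => hint i hi j hj]
        refine Finset.sum_congr rfl fun i hi => ?_
        rw [integral_finsetSum _ fun j hj => hint i hi j hj,
          Finset.sum_congr rfl fun j hj => hpair i hi j hj]
        simp [hi]
    _ = _ := by
        rw [← integral_finsetSum _ fun i hi => hGb _ (hζi i hi)]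
        simp only [Finset.sum_mul]

end Replacement

/-! ### Samples from two arms, and the central limit theorem -/

section ArmSample

variable {S Ω : Type*} [MeasurableSpace S] [MeasurableSpace Ω]

/-- A sample from two populations `κ 0`, `κ 1`: the `W i` are independent, and `W i` is drawn from
`κ (τ i)`, for a fixed assignment `τ` of the units to the two arms. -/
structure IsArmSample (κ : Fin 2 → Measure S) (τ : ℕ → Fin 2) (P : Measure Ω) (W : ℕ → Ω → S) :
    Prop where
  measurable : ∀ i, Measurable (W i)
  indep : iIndepFun W P
  law : ∀ i, P.map (W i) = κ (τ i)

/-- The units among `0, …, n-1` in arm `s`. -/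
def armIdx (τ : ℕ → Fin 2) (n : ℕ) (s : Fin 2) : Finset ℕ :=
  (Finset.range n).filter fun i => τ i = s

/-- The average of `g` over the units among `0, …, n-1` in arm `s` (`0` if there are none). -/
noncomputable def armAvg (τ : ℕ → Fin 2) (W : ℕ → Ω → S) (s : Fin 2) (g : S → ℝ) (n : ℕ) (ω : Ω) :
    ℝ :=
  (∑ i ∈ armIdx τ n s, g (W i ω)) / groupSize τ n s

lemma groupSize_eq_card (τ : ℕ → Fin 2) (n : ℕ) (s : Fin 2) :
    groupSize τ n s = (armIdx τ n s).card := by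
  simp [groupSize, armIdx]

lemma mem_armIdx {τ : ℕ → Fin 2} {n : ℕ} {s : Fin 2} {i : ℕ} :
    i ∈ armIdx τ n s ↔ i < n ∧ τ i = s := by
  simp [armIdx]

lemma groupSize_nonneg (τ : ℕ → Fin 2) (n : ℕ) (s : Fin 2) : 0 ≤ groupSize τ n s := by
  rw [groupSize_eq_card]; positivity

lemma tendsto_groupSize_atTop {τ : ℕ → Fin 2} {s : Fin 2} {q : ℝ} (hq : 0 < q)
    (h : Tendsto (fun n : ℕ => groupSize τ n s / n) atTop (𝓝 q)) :
    Tendsto (fun n : ℕ => groupSize τ n s) atTop atTop := by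
  have := h.pos_mul_atTop hq (tendsto_natCast_atTop_atTop (R := ℝ))
  refine this.congr' ?_
  filter_upwards [eventually_gt_atTop 0] with n hn
  have : (n : ℝ) ≠ 0 := by positivity
  field_simp

lemma tendsto_div_groupSize {τ : ℕ → Fin 2} {s : Fin 2} {q : ℝ} (hq : 0 < q)
    (h : Tendsto (fun n : ℕ => groupSize τ n s / n) atTop (𝓝 q)) :
    Tendsto (fun n : ℕ => (n : ℝ) / groupSize τ n s) atTop (𝓝 (1 / q)) := by
  refine ((h.inv₀ hq.ne').congr fun n => ?_).trans_eq (by simp)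
  rw [inv_div]

lemma tendsto_mul_exp_neg_groupSize {τ : ℕ → Fin 2} {t : Fin 2} {q b : ℝ} (hq : 0 < q) (hb : 0 < b)
    (hτ : Tendsto (fun n : ℕ => groupSize τ n t / n) atTop (𝓝 q)) :
    Tendsto (fun n : ℕ => (n : ℝ) * Real.exp (-b * groupSize τ n t)) atTop (𝓝 0) := by
  have h1 : Tendsto (fun x : ℝ => x * Real.exp (-b * x)) atTop (𝓝 0) := by
    simpa using tendsto_rpow_mul_exp_neg_mul_atTop_nhds_zero 1 b hb
  have h2 := (tendsto_div_groupSize hq hτ).mul (h1.comp (tendsto_groupSize_atTop hq hτ))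
  rw [mul_zero] at h2
  refine h2.congr' ?_
  filter_upwards [(tendsto_groupSize_atTop hq hτ).eventually_gt_atTop 0] with n hn
  simp only [Function.comp]
  field_simp

/-- Summing over one arm is summing along the increasing enumeration of that arm. -/
lemma sum_armIdx_eq (τ : ℕ → Fin 2) (s : Fin 2) (f : ℕ → ℝ) (n : ℕ) :
    ∑ i ∈ armIdx τ n s, f i
      = ∑ k ∈ Finset.range (armIdx τ n s).card, f (Nat.nth (fun i => τ i = s) k) := by
  have hc : ∀ n, (armIdx τ n s).card = Nat.count (fun i => τ i = s) n := fun n => by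
    rw [Nat.count_eq_card_filter_range, armIdx]
  induction n with
  | zero => simp [armIdx]
  | succ n ih =>
    rw [hc] at ih ⊢
    rw [Nat.count_succ]
    have hs : armIdx τ (n + 1) s = if τ n = s then insert n (armIdx τ n s) else armIdx τ n s := by
      rw [armIdx, Finset.range_add_one, Finset.filter_insert]
      rfl
    rw [hs]
    split_ifs with h
    · rw [Finset.sum_insert (by simp [armIdx]), ih, Finset.sum_range_succ, add_comm,
        Nat.nth_count h]
    · simpa using ih

namespace IsArmSample

variable {κ : Fin 2 → Measure S} {τ : ℕ → Fin 2} {P : Measure Ω} {W : ℕ → Ω → S}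
  {s s' : Fin 2} {g h : S → ℝ}

lemma measurable_armAvg (H : IsArmSample κ τ P W) (hg : Measurable g) (n : ℕ) :
    Measurable (armAvg τ W s g n) :=
  (Finset.measurable_fun_sum _ fun i _ => hg.comp (H.measurable i)).div_const _

lemma integral_comp (H : IsArmSample κ τ P W) (hg : Measurable g) (i : ℕ) :
    ∫ ω, g (W i ω) ∂P = ∫ x, g x ∂(κ (τ i)) := by
  rw [← H.law i, integral_map (H.measurable i).aemeasurable hg.aestronglyMeasurable]

lemma memLp_comp (H : IsArmSample κ τ P W) (hg : MemLp g 2 (κ s)) {i : ℕ} (hi : τ i = s) :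
    MemLp (fun ω => g (W i ω)) 2 P := by
  subst hi
  rw [← H.law i] at hg
  exact hg.comp_of_map (H.measurable i).aemeasurable

lemma variance_comp (H : IsArmSample κ τ P W) (hg : Measurable g) (i : ℕ) :
    variance (fun ω => g (W i ω)) P = variance g (κ (τ i)) := by
  rw [← H.law i, variance_map hg.aemeasurable (H.measurable i).aemeasurable]
  rfl

lemma memLp_armAvg (H : IsArmSample κ τ P W) (hg : MemLp g 2 (κ s)) (n : ℕ) :
    MemLp (armAvg τ W s g n) 2 P := by
  have : MemLp (fun ω => ∑ i ∈ armIdx τ n s, g (W i ω)) 2 P :=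
    memLp_finsetSum _ fun i hi => H.memLp_comp hg (mem_armIdx.mp hi).2
  refine (this.const_mul (groupSize τ n s)⁻¹).ae_eq (ae_of_all _ fun ω => ?_)
  rw [armAvg, div_eq_inv_mul]

lemma integral_armAvg [IsFiniteMeasure P] (H : IsArmSample κ τ P W) (hgm : Measurable g)
    (hg : MemLp g 2 (κ s)) {n : ℕ} (hn : groupSize τ n s ≠ 0) :
    ∫ ω, armAvg τ W s g n ω ∂P = ∫ x, g x ∂(κ s) := by
  simp only [armAvg]
  rw [integral_div, integral_finsetSum _ fun i hi =>
    (H.memLp_comp hg (mem_armIdx.mp hi).2).integrable one_le_two]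
  have : ∀ i ∈ armIdx τ n s, ∫ ω, g (W i ω) ∂P = ∫ x, g x ∂(κ s) := fun i hi => by
    rw [H.integral_comp hgm, (mem_armIdx.mp hi).2]
  rw [Finset.sum_congr rfl this, Finset.sum_const, nsmul_eq_mul, ← groupSize_eq_card]
  field_simp

lemma variance_armAvg (H : IsArmSample κ τ P W) (hgm : Measurable g)
    (hg : MemLp g 2 (κ s)) (n : ℕ) :
    variance (armAvg τ W s g n) P = variance g (κ s) / groupSize τ n s := by
  have hsum : variance (∑ i ∈ armIdx τ n s, fun ω => g (W i ω)) P
      = groupSize τ n s * variance g (κ s) := by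
    rw [IndepFun.variance_sum (fun i hi => H.memLp_comp hg (mem_armIdx.mp hi).2)
      fun i _ j _ hij => (H.indep.indepFun hij).comp hgm hgm]
    have : ∀ i ∈ armIdx τ n s, variance (fun ω => g (W i ω)) P = variance g (κ s) := fun i hi => by
      rw [H.variance_comp hgm, (mem_armIdx.mp hi).2]
    rw [Finset.sum_congr rfl this, Finset.sum_const, nsmul_eq_mul, ← groupSize_eq_card]
  have he : armAvg τ W s g n
      = fun ω => (groupSize τ n s)⁻¹ * (∑ i ∈ armIdx τ n s, fun ω => g (W i ω)) ω := by
    ext ω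
    simp [armAvg, div_eq_mul_inv, mul_comm]
  rw [he, variance_const_mul, hsum]
  by_cases hn : groupSize τ n s = 0
  · simp [hn]
  · field_simp

lemma indepFun_armAvg (H : IsArmSample κ τ P W) (hg : Measurable g) (hh : Measurable h)
    (hs : s ≠ s') (n : ℕ) : IndepFun (armAvg τ W s g n) (armAvg τ W s' h n) P := by
  have hd : Disjoint (armIdx τ n s) (armIdx τ n s') := by
    rw [Finset.disjoint_left]
    intro i hi hi'
    exact hs ((mem_armIdx.mp hi).2.symm.trans (mem_armIdx.mp hi').2)
  have := H.indep.indepFun_finset (armIdx τ n s) (armIdx τ n s') hd H.measurable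
  have hm : ∀ (r : Fin 2) {f : S → ℝ}, Measurable f → Measurable
      (fun x : armIdx τ n r → S => (∑ i, f (x i)) / groupSize τ n r) := fun r f hf =>
    (Finset.measurable_fun_sum _ fun i _ => hf.comp (measurable_pi_apply i)).div_const _
  refine (this.comp (hm s hg) (hm s' hh)).congr (ae_of_all _ fun ω => ?_) (ae_of_all _ fun ω => ?_)
  all_goals
    simp only [Function.comp, armAvg]
    congr 1
  · exact Finset.sum_coe_sort (armIdx τ n s) fun i => g (W i ω)
  · exact Finset.sum_coe_sort (armIdx τ n s') fun i => h (W i ω)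

/-- Central limit theorem within one arm, in terms of characteristic functions. -/
lemma tendsto_charFun_armAvg [IsProbabilityMeasure P] (H : IsArmSample κ τ P W)
    (hgm : Measurable g) (hg : MemLp g 2 (κ s)) {q : ℝ} (hq : 0 < q)
    (hτ : Tendsto (fun n : ℕ => groupSize τ n s / n) atTop (𝓝 q)) (u : ℝ) :
    Tendsto (fun n : ℕ =>
        charFun (P.map fun ω => √(n : ℝ) * (armAvg τ W s g n ω - ∫ x, g x ∂(κ s))) u)
      atTop (𝓝 (charFun (gaussianReal 0 (variance g (κ s) / q).toNNReal) u)) := by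
  have hcard : Tendsto (fun n : ℕ => (armIdx τ n s).card) atTop atTop := by
    rw [← tendsto_natCast_atTop_iff (R := ℝ)]
    exact (tendsto_groupSize_atTop hq hτ).congr fun n => groupSize_eq_card τ n s
  have hinf : {i | τ i = s}.Infinite := by
    intro hfin
    obtain ⟨n, hn⟩ := (hcard.eventually_gt_atTop hfin.toFinset.card).exists
    refine absurd (Finset.card_le_card (fun i hi => ?_)) (not_le.mpr hn)
    exact hfin.mem_toFinset.mpr (mem_armIdx.mp hi).2
  -- `e` enumerates the arm, and the units in it are an i.i.d. sequence
  set e : ℕ → ℕ := Nat.nth fun i => τ i = s with he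
  have hτe : ∀ k, τ (e k) = s := fun k => Nat.nth_mem_of_infinite hinf k
  set X : ℕ → Ω → ℝ := fun k ω => g (W (e k) ω) with hX
  have hXi : iIndepFun X P :=
    (H.indep.precomp (Nat.nth_injective hinf)).comp (fun _ => g) fun _ => hgm
  have hid : ∀ k, IdentDistrib (X k) (X 0) P P := fun k => by
    refine IdentDistrib.comp (u := g) (f := W (e k)) (g := W (e 0))
      ⟨(H.measurable _).aemeasurable, (H.measurable _).aemeasurable, ?_⟩ hgm
    rw [H.law, H.law, hτe, hτe]
  have hXL : MemLp (X 0) 2 P := H.memLp_comp hg (hτe 0)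
  have hXE : ∫ ω, X 0 ω ∂P = ∫ x, g x ∂(κ s) := by rw [H.integral_comp hgm, hτe]
  have hXV : variance (X 0) P = variance g (κ s) := by rw [H.variance_comp hgm, hτe]
  set v := variance g (κ s) with hv
  have hv0 : 0 ≤ v := variance_nonneg _ _
  have hclt := tendstoInDistribution_inv_sqrt_mul_sum_sub (X := X) (P := P)
    (Y := id) (P' := gaussianReal 0 (variance (X 0) P).toNNReal) ⟨aemeasurable_id, Measure.map_id⟩
    hXL hXi hid
  have hsub : TendstoInDistribution
      (fun (n : ℕ) ω => (√((armIdx τ n s).card : ℝ))⁻¹ *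
        (∑ k ∈ Finset.range (armIdx τ n s).card, X k ω - (armIdx τ n s).card * ∫ ω, X 0 ω ∂P))
      atTop id (fun _ => P) (gaussianReal 0 (variance (X 0) P).toNNReal) :=
    ⟨fun n => hclt.forall_aemeasurable _, hclt.aemeasurable_limit, hclt.tendsto.comp hcard⟩
  -- rescaling from the size of the arm to `n` is a case of Slutsky's theorem
  have hconst : TendstoInMeasure P (fun (n : ℕ) (_ : Ω) => √((n : ℝ) / groupSize τ n s)) atTop
      (fun _ => √(1 / q)) := by
    refine tendstoInMeasure_of_tendsto_ae (fun n => aestronglyMeasurable_const)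
      (ae_of_all _ fun ω => ?_)
    exact (Real.continuous_sqrt.tendsto _).comp (tendsto_div_groupSize hq hτ)
  have hprod := hsub.continuous_comp_prodMk_of_tendstoInMeasure_const
    (g := fun p : ℝ × ℝ => p.2 * p.1) (by fun_prop) hconst (fun _ => aemeasurable_const)
  have hchar := ProbabilityMeasure.tendsto_iff_tendsto_charFun.mp hprod.tendsto u
  have hlim : (gaussianReal 0 (variance (X 0) P).toNNReal).map (fun ω => √(1 / q) * id ω)
      = gaussianReal 0 (v / q).toNNReal := by
    rw [show (fun ω : ℝ => √(1 / q) * id ω) = (√(1 / q) * ·) from rfl, gaussianReal_map_const_mul,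
      hXV]
    congr 1
    · simp
    · ext
      simp only [NNReal.coe_mul, NNReal.coe_mk, Real.coe_toNNReal _ hv0,
        Real.coe_toNNReal _ (div_nonneg hv0 hq.le), Real.sq_sqrt (one_div_pos.mpr hq).le]
      ring
  simp only [ProbabilityMeasure.coe_mk] at hchar
  rw [hlim] at hchar
  refine hchar.congr' ?_
  filter_upwards [(tendsto_groupSize_atTop hq hτ).eventually_gt_atTop 0] with n hn
  congr 2
  ext ω
  rw [← sum_armIdx_eq τ s (fun i => g (W i ω)) n, hXE, ← groupSize_eq_card, armAvg,
    Real.sqrt_div (Nat.cast_nonneg n)]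
  have h2 : √(groupSize τ n s) * √(groupSize τ n s) = groupSize τ n s := Real.mul_self_sqrt hn.le
  have h3 : √(groupSize τ n s) ≠ 0 := (Real.sqrt_pos.mpr hn).ne'
  set r := √(groupSize τ n s)
  rw [← h2]
  field_simp

/-- Central limit theorem for the difference of the averages in the two arms. -/
lemma tendstoInDistribution_armAvg_sub [IsProbabilityMeasure P] (H : IsArmSample κ τ P W)
    (hs : s ≠ s') (hgm : Measurable g) (hhm : Measurable h)
    (hg : MemLp g 2 (κ s)) (hh : MemLp h 2 (κ s')) {q q' : ℝ} (hq : 0 < q) (hq' : 0 < q')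
    (hτ : Tendsto (fun n : ℕ => groupSize τ n s / n) atTop (𝓝 q))
    (hτ' : Tendsto (fun n : ℕ => groupSize τ n s' / n) atTop (𝓝 q')) :
    TendstoInDistribution (fun (n : ℕ) ω => √(n : ℝ) * (armAvg τ W s g n ω - ∫ x, g x ∂(κ s))
        + √(n : ℝ) * (armAvg τ W s' h n ω - ∫ x, h x ∂(κ s')))
      atTop id (fun _ => P)
      (gaussianReal 0 (variance g (κ s) / q + variance h (κ s') / q').toNNReal) := by
  have hm : ∀ n : ℕ, Measurable fun ω => √(n : ℝ) * (armAvg τ W s g n ω - ∫ x, g x ∂(κ s)) :=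
    fun n => ((H.measurable_armAvg hgm n).sub_const _).const_mul _
  have hm' : ∀ n : ℕ, Measurable fun ω => √(n : ℝ) * (armAvg τ W s' h n ω - ∫ x, h x ∂(κ s')) :=
    fun n => ((H.measurable_armAvg hhm n).sub_const _).const_mul _
  refine ⟨fun n => ((hm n).add (hm' n)).aemeasurable, aemeasurable_id, ?_⟩
  refine ProbabilityMeasure.tendsto_iff_tendsto_charFun.mpr fun u => ?_
  have h1 := (H.tendsto_charFun_armAvg hgm hg hq hτ u).mul
    (H.tendsto_charFun_armAvg hhm hh hq' hτ' u)
  have hlim : charFun (gaussianReal 0 (variance g (κ s) / q).toNNReal) u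
      * charFun (gaussianReal 0 (variance h (κ s') / q').toNNReal) u
      = charFun ((gaussianReal 0
          (variance g (κ s) / q + variance h (κ s') / q').toNNReal).map id) u := by
    rw [Measure.map_id, Real.toNNReal_add (div_nonneg (variance_nonneg _ _) hq.le)
      (div_nonneg (variance_nonneg _ _) hq'.le)]
    have := charFun_conv (μ := gaussianReal 0 (variance g (κ s) / q).toNNReal)
      (ν := gaussianReal 0 (variance h (κ s') / q').toNNReal) u
    rw [gaussianReal_conv_gaussianReal] at this
    simpa using this.symm
  rw [hlim] at h1
  refine h1.congr fun n => ?_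
  have hi : IndepFun (fun ω => √(n : ℝ) * (armAvg τ W s g n ω - ∫ x, g x ∂(κ s)))
      (fun ω => √(n : ℝ) * (armAvg τ W s' h n ω - ∫ x, h x ∂(κ s'))) P :=
    (H.indepFun_armAvg hgm hhm hs n).comp
      (φ := fun x => √(n : ℝ) * (x - ∫ x, g x ∂(κ s)))
      (ψ := fun x => √(n : ℝ) * (x - ∫ x, h x ∂(κ s'))) (by fun_prop) (by fun_prop)
  have := congrFun (hi.charFun_map_fun_add_eq_mul (hm n).aemeasurable (hm' n).aemeasurable) u
  exact this.symm

end IsArmSample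

end ArmSample

/-! ### Statistics that are linear up to a small error -/

section Remainder

variable {S Ω : Type*} [MeasurableSpace S] [MeasurableSpace Ω]

/-- Cauchy–Schwarz inequality for the covariance. -/
lemma sq_covariance_le {P : Measure Ω} [IsFiniteMeasure P] {X Y : Ω → ℝ} (hX : MemLp X 2 P)
    (hY : MemLp Y 2 P) : covariance X Y P ^ 2 ≤ variance X P * variance Y P := by
  -- the variance of `x • X + Y` is a nonnegative quadratic polynomial in `x`
  have h : ∀ x : ℝ, 0 ≤ variance X P * (x * x) + 2 * covariance X Y P * x + variance Y P := by
    intro x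
    have := variance_nonneg ((fun ω => x * X ω) + Y) P
    rw [variance_add (hX.const_mul x) hY, variance_const_mul, covariance_const_mul_left] at this
    linarith
  have := discrim_le_zero h
  rw [discrim] at this
  nlinarith

lemma tendstoInMeasure_zero_of_tendsto_integral_sq {P : Measure Ω} {D : ℕ → Ω → ℝ}
    (hD : ∀ n, MemLp (D n) 2 P) (h : Tendsto (fun n => ∫ ω, D n ω ^ 2 ∂P) atTop (𝓝 0)) :
    TendstoInMeasure P D atTop (fun _ => 0) := by
  refine tendstoInMeasure_of_tendsto_eLpNorm two_ne_zero (fun n => (hD n).aestronglyMeasurable)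
    aestronglyMeasurable_const ?_
  have he : ∀ n, eLpNorm (D n - fun _ => 0) 2 P
      = ENNReal.ofReal ((∫ ω, D n ω ^ 2 ∂P) ^ (2⁻¹ : ℝ)) := by
    intro n
    rw [show (D n - fun _ => (0 : ℝ)) = D n by ext; simp,
      (hD n).eLpNorm_eq_integral_rpow_norm two_ne_zero ENNReal.ofNat_ne_top]
    simp
  simp_rw [he]
  have := (Real.continuousAt_rpow_const 0 (2⁻¹ : ℝ) (Or.inr (by norm_num))).tendsto.comp h
  have h2 := (ENNReal.continuous_ofReal.tendsto _).comp this
  simpa [Function.comp_def] using h2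

namespace IsArmSample

variable {κ : Fin 2 → Measure S} {τ : ℕ → Fin 2} {P : Measure Ω} {W : ℕ → Ω → S}
  {s s' : Fin 2} {g h : S → ℝ} {T : ℕ → Ω → ℝ}

/-- Variance of a statistic that is linear up to an error of order `o(n^{-1/2})` in `L²`. -/
lemma tendsto_mul_variance [IsProbabilityMeasure P] (H : IsArmSample κ τ P W)
    (hs : s ≠ s') (hgm : Measurable g) (hhm : Measurable h)
    (hg : MemLp g 2 (κ s)) (hh : MemLp h 2 (κ s')) {q q' : ℝ} (hq : 0 < q) (hq' : 0 < q')
    (hτ : Tendsto (fun n : ℕ => groupSize τ n s / n) atTop (𝓝 q))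
    (hτ' : Tendsto (fun n : ℕ => groupSize τ n s' / n) atTop (𝓝 q'))
    (hT : ∀ n, MemLp (T n) 2 P)
    (hrem : Tendsto (fun n : ℕ => (n : ℝ) *
      ∫ ω, (T n ω - (armAvg τ W s g n ω + armAvg τ W s' h n ω)) ^ 2 ∂P) atTop (𝓝 0)) :
    Tendsto (fun n : ℕ => (n : ℝ) * variance (T n) P) atTop
      (𝓝 (variance g (κ s) / q + variance h (κ s') / q')) := by
  set L : ℕ → Ω → ℝ := fun n => armAvg τ W s g n + armAvg τ W s' h n with hL
  set D : ℕ → Ω → ℝ := fun n => T n - L n with hDdef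
  have hLm : ∀ n, MemLp (L n) 2 P := fun n => (H.memLp_armAvg hg n).add (H.memLp_armAvg hh n)
  have hDm : ∀ n, MemLp (D n) 2 P := fun n => (hT n).sub (hLm n)
  have hVL : Tendsto (fun n : ℕ => (n : ℝ) * variance (L n) P) atTop
      (𝓝 (variance g (κ s) / q + variance h (κ s') / q')) := by
    have h1 := ((tendsto_div_groupSize hq hτ).const_mul (variance g (κ s))).add
      ((tendsto_div_groupSize hq' hτ').const_mul (variance h (κ s')))
    refine (h1.congr fun n => ?_).trans_eq (by ring_nf)
    rw [hL, (H.indepFun_armAvg hgm hhm hs n).variance_add (H.memLp_armAvg hg n)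
      (H.memLp_armAvg hh n), H.variance_armAvg hgm hg, H.variance_armAvg hhm hh]
    ring
  have hVD : Tendsto (fun n : ℕ => (n : ℝ) * variance (D n) P) atTop (𝓝 0) := by
    refine squeeze_zero (fun n => mul_nonneg (Nat.cast_nonneg n) (variance_nonneg _ _))
      (fun n => ?_) hrem
    exact mul_le_mul_of_nonneg_left (variance_le_expectation_sq (hDm n).aestronglyMeasurable)
      (Nat.cast_nonneg n)
  have hcov : Tendsto (fun n : ℕ => (n : ℝ) * covariance (L n) (D n) P) atTop (𝓝 0) := by
    have h0 : Tendsto (fun n : ℕ => √(((n : ℝ) * variance (L n) P) * (n * variance (D n) P)))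
        atTop (𝓝 0) := by
      simpa using (hVL.mul hVD).sqrt
    refine squeeze_zero_norm (fun n => ?_) h0
    rw [Real.norm_eq_abs]
    refine Real.abs_le_sqrt ?_
    have := mul_le_mul_of_nonneg_left (sq_covariance_le (hLm n) (hDm n)) (sq_nonneg (n : ℝ))
    nlinarith
  have := (hVL.add (hcov.const_mul 2)).add hVD
  simp only [mul_zero, add_zero] at this
  refine this.congr fun n => ?_
  have hTn : T n = L n + D n := by simp [hDdef]
  rw [hTn, variance_add (hLm n) (hDm n)]
  ring

/-- Asymptotic normality of a statistic that is linear up to an error of order `o(n^{-1/2})` in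
`L²`. -/
lemma tendstoInDistribution_of_remainder [IsProbabilityMeasure P] (H : IsArmSample κ τ P W)
    (hs : s ≠ s') (hgm : Measurable g) (hhm : Measurable h)
    (hg : MemLp g 2 (κ s)) (hh : MemLp h 2 (κ s')) {q q' : ℝ} (hq : 0 < q) (hq' : 0 < q')
    (hτ : Tendsto (fun n : ℕ => groupSize τ n s / n) atTop (𝓝 q))
    (hτ' : Tendsto (fun n : ℕ => groupSize τ n s' / n) atTop (𝓝 q'))
    (hT : ∀ n, MemLp (T n) 2 P)
    (hrem : Tendsto (fun n : ℕ => (n : ℝ) *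
      ∫ ω, (T n ω - (armAvg τ W s g n ω + armAvg τ W s' h n ω)) ^ 2 ∂P) atTop (𝓝 0)) :
    TendstoInDistribution
      (fun (n : ℕ) ω => √(n : ℝ) * (T n ω - (∫ x, g x ∂(κ s) + ∫ x, h x ∂(κ s'))))
      atTop id (fun _ => P)
      (gaussianReal 0 (variance g (κ s) / q + variance h (κ s') / q').toNNReal) := by
  set D : ℕ → Ω → ℝ :=
    fun n ω => √(n : ℝ) * (T n ω - (armAvg τ W s g n ω + armAvg τ W s' h n ω)) with hDdef
  have hDm : ∀ n, MemLp (D n) 2 P := fun n =>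
    ((hT n).sub ((H.memLp_armAvg hg n).add (H.memLp_armAvg hh n))).const_mul _
  have hD : TendstoInMeasure P D atTop (fun _ => 0) := by
    refine tendstoInMeasure_zero_of_tendsto_integral_sq hDm (hrem.congr fun n => ?_)
    rw [← integral_const_mul]
    refine integral_congr_ae (ae_of_all _ fun ω => ?_)
    simp only [hDdef, mul_pow, Real.sq_sqrt (Nat.cast_nonneg n)]
  have := (H.tendstoInDistribution_armAvg_sub hs hgm hhm hg hh hq hq' hτ hτ'
    ).add_of_tendstoInMeasure_const hD fun n => (hDm n).aemeasurable
  refine this.congr (fun n => ae_of_all _ fun ω => ?_) (ae_of_all _ fun ω => ?_)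
  · simp only [hDdef, Pi.add_apply]
    ring
  · simp

end IsArmSample

end Remainder

/-! ### Cells: shares and residuals -/

section CellShares

variable {S Ω : Type*} {J : ℕ}

/-- The indicator of the cell `c = m`. -/
def cellInd (c : S → Fin J) (m : Fin J) (x : S) : ℝ := if c x = m then 1 else 0

/-- The outcome `y` centred at `a` within the cell `c = m`, and `0` outside this cell. -/
def cellRes (c : S → Fin J) (y : S → ℝ) (m : Fin J) (a : ℝ) (x : S) : ℝ :=
  if c x = m then y x - a else 0

lemma cellInd_nonneg (c : S → Fin J) (m : Fin J) (x : S) : 0 ≤ cellInd c m x := by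
  unfold cellInd; split_ifs <;> norm_num

lemma cellInd_le_one (c : S → Fin J) (m : Fin J) (x : S) : cellInd c m x ≤ 1 := by
  unfold cellInd; split_ifs <;> norm_num

lemma cellRes_eq_indicator (c : S → Fin J) (y : S → ℝ) (m : Fin J) (a : ℝ) :
    cellRes c y m a = (c ⁻¹' {m}).indicator fun x => y x - a := by
  ext x
  by_cases h : c x = m <;> simp [cellRes, h]

lemma armAvg_cellInd_nonneg (τ : ℕ → Fin 2) (W : ℕ → Ω → S) (s : Fin 2) (c : S → Fin J)
    (m : Fin J) (n : ℕ) (ω : Ω) : 0 ≤ armAvg τ W s (cellInd c m) n ω :=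
  div_nonneg (Finset.sum_nonneg fun _ _ => cellInd_nonneg c m _) (groupSize_nonneg τ n s)

lemma armAvg_cellInd_le_one (τ : ℕ → Fin 2) (W : ℕ → Ω → S) (s : Fin 2) (c : S → Fin J)
    (m : Fin J) (n : ℕ) (ω : Ω) : armAvg τ W s (cellInd c m) n ω ≤ 1 := by
  refine div_le_one_of_le₀ ?_ (groupSize_nonneg τ n s)
  rw [groupSize_eq_card]
  calc ∑ i ∈ armIdx τ n s, cellInd c m (W i ω) ≤ ∑ i ∈ armIdx τ n s, 1 :=
        Finset.sum_le_sum fun i _ => cellInd_le_one c m _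
    _ = _ := by simp

/-- In an arm, a cell is either empty, or has a share of at least one unit. -/
lemma armAvg_cellInd_eq_zero_or (τ : ℕ → Fin 2) (W : ℕ → Ω → S) (s : Fin 2) (c : S → Fin J)
    (m : Fin J) {n : ℕ} (ω : Ω) :
    (∀ i ∈ armIdx τ n s, c (W i ω) ≠ m) ∨
      1 / groupSize τ n s ≤ armAvg τ W s (cellInd c m) n ω := by
  by_cases h : ∀ i ∈ armIdx τ n s, c (W i ω) ≠ m
  · exact Or.inl h
  · right
    push Not at h
    obtain ⟨i, hi, him⟩ := h
    refine div_le_div_of_nonneg_right ?_ (groupSize_nonneg τ n s)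
    calc (1 : ℝ) = cellInd c m (W i ω) := by simp [cellInd, him]
      _ ≤ _ := Finset.single_le_sum (f := fun i => cellInd c m (W i ω))
        (fun _ _ => cellInd_nonneg c m _) hi

lemma armAvg_const_mul (τ : ℕ → Fin 2) (W : ℕ → Ω → S) (s : Fin 2)
    (e : ℝ) (g : S → ℝ) (n : ℕ) (ω : Ω) :
    armAvg τ W s (fun x => e * g x) n ω = e * armAvg τ W s g n ω := by
  rw [armAvg, armAvg, ← Finset.mul_sum, mul_div_assoc]

lemma sum_armIdx_eq_sum_fin (τ : ℕ → Fin 2) (s : Fin 2) (n : ℕ) (f : ℕ → ℝ) :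
    ∑ i ∈ armIdx τ n s, f i
      = ∑ i ∈ Finset.univ.filter (fun i : Fin n => τ i = s), f i := by
  rw [armIdx, Finset.sum_filter, Finset.sum_filter,
    ← Fin.sum_univ_eq_sum_range (fun i => if τ i = s then f i else 0)]

variable [MeasurableSpace S] [MeasurableSpace Ω]

section Cells

variable {c : S → Fin J} {y : S → ℝ}

lemma measurable_cellInd (hc : Measurable c) (m : Fin J) : Measurable (cellInd c m) :=
  measurable_class_ite hc measurable_const m

lemma measurable_cellRes (hc : Measurable c) (hy : Measurable y) (m : Fin J) (a : ℝ) :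
    Measurable (cellRes c y m a) :=
  measurable_class_ite hc (hy.sub_const a) m

lemma memLp_cellInd (hc : Measurable c) (m : Fin J) (μ : Measure S) [IsFiniteMeasure μ] :
    MemLp (cellInd c m) 2 μ := by
  refine MemLp.of_bound (measurable_cellInd hc m).aestronglyMeasurable 1 (ae_of_all _ fun x => ?_)
  rw [Real.norm_of_nonneg (cellInd_nonneg c m x)]
  exact cellInd_le_one c m x

lemma memLp_cellRes (hc : Measurable c) (m : Fin J) (a : ℝ) {μ : Measure S} [IsFiniteMeasure μ]
    (hy : MemLp y 2 μ) : MemLp (cellRes c y m a) 2 μ := by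
  rw [cellRes_eq_indicator]
  exact (hy.sub (memLp_const a)).indicator (hc (measurableSet_singleton m))

lemma integral_cellInd (hc : Measurable c) (m : Fin J) (μ : Measure S) :
    ∫ x, cellInd c m x ∂μ = μ.real {x | c x = m} := by
  have : cellInd c m = ({x | c x = m} : Set S).indicator 1 := by
    ext x
    by_cases h : c x = m <;> simp [cellInd, h]
  rw [this]
  exact integral_indicator_one (hc (measurableSet_singleton m))

end Cells

namespace IsArmSample

variable {κ : Fin 2 → Measure S} {τ : ℕ → Fin 2} {P : Measure Ω} {W : ℕ → Ω → S}
  {s s' : Fin 2} {c : S → Fin J} {y : S → ℝ} {m : Fin J}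

/-- Exponential bound for the probability that the share of a cell in an arm falls below half of its
expectation. -/
lemma measure_cell_share_lt_le [IsProbabilityMeasure P] (H : IsArmSample κ τ P W)
    (hc : Measurable c) (s : Fin 2) (m : Fin J) {n : ℕ} (hn : 0 < groupSize τ n s) :
    P.real {ω | armAvg τ W s (cellInd c m) n ω < (κ s).real {x | c x = m} / 2}
      ≤ Real.exp (-((κ s).real {x | c x = m} ^ 2 / 2) * groupSize τ n s) := by
  set ν := (κ s).real {x | c x = m} with hν
  have hIm := measurable_cellInd hc m
  -- Hoeffding's inequality for the centred sum of the variables `-cellInd c m (W i)`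
  set X : ℕ → Ω → ℝ := fun i ω => -cellInd c m (W i ω) - ∫ ω', -cellInd c m (W i ω') ∂P with hX
  have hXi : iIndepFun X P :=
    H.indep.comp (fun i x => -cellInd c m x - ∫ ω', -cellInd c m (W i ω') ∂P)
      fun i => hIm.neg.sub_const _
  have hsub : ∀ i ∈ armIdx τ n s, HasSubgaussianMGF (X i) ((‖(0 : ℝ) - (-1)‖₊ / 2) ^ 2) P :=
    fun i _ => hasSubgaussianMGF_of_mem_Icc (hIm.comp (H.measurable i)).neg.aemeasurable
      (ae_of_all _ fun ω => ⟨neg_le_neg (cellInd_le_one c m _),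
        neg_nonpos.mpr (cellInd_nonneg c m _)⟩)
  have hν0 : 0 ≤ ν := measureReal_nonneg
  have := HasSubgaussianMGF.measure_sum_ge_le_of_iIndepFun hXi hsub
    (ε := groupSize τ n s * ν / 2) (by positivity)
  refine (measureReal_mono fun ω hω => ?_).trans (this.trans_eq ?_)
  · have hω' : armAvg τ W s (cellInd c m) n ω < ν / 2 := hω
    rw [armAvg, div_lt_iff₀ hn] at hω'
    have hsum : ∑ i ∈ armIdx τ n s, X i ω
        = groupSize τ n s * ν - ∑ i ∈ armIdx τ n s, cellInd c m (W i ω) := by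
      have : ∀ i ∈ armIdx τ n s, X i ω = ν - cellInd c m (W i ω) := fun i hi => by
        simp only [hX]
        rw [integral_neg, H.integral_comp hIm, (mem_armIdx.mp hi).2, integral_cellInd hc]
        ring
      rw [Finset.sum_congr rfl this, Finset.sum_sub_distrib, Finset.sum_const, nsmul_eq_mul,
        groupSize_eq_card]
    change _ ≤ ∑ i ∈ armIdx τ n s, X i ω
    rw [hsum]
    linarith
  · congr 1
    rw [Finset.sum_const, nsmul_eq_mul]
    simp only [NNReal.coe_mul, NNReal.coe_natCast, NNReal.coe_pow, NNReal.coe_div, coe_nnnorm]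
    rw [← groupSize_eq_card]
    norm_num
    field_simp
    ring

/-- Given the cells of all units, the residuals of a cell are uncorrelated with mean `0` and
variance `σ²`; so the square of their average can be replaced by its conditional expectation. -/
lemma integral_sq_armAvg_cellRes_mul [IsProbabilityMeasure P] [∀ s, IsProbabilityMeasure (κ s)]
    (H : IsArmSample κ τ P W) (hc : Measurable c) (hy : Measurable y) (hyL : MemLp y 2 (κ s))
    {a σ2 : ℝ} (h0 : ∫ x, cellRes c y m a x ∂(κ s) = 0)
    (h1 : ∫ x, cellRes c y m a x ^ 2 ∂(κ s) = (κ s).real {x | c x = m} * σ2)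
    (n : ℕ) (G : (Fin n → Fin J) → ℝ) :
    ∫ ω, armAvg τ W s (cellRes c y m a) n ω ^ 2 * G (fun i => c (W i ω)) ∂P
      = σ2 / groupSize τ n s *
        ∫ ω, armAvg τ W s (cellInd c m) n ω * G (fun i => c (W i ω)) ∂P := by
  have hξm := measurable_cellRes hc hy m a
  have hIm := measurable_cellInd hc m
  have hξL := memLp_cellRes hc m a hyL
  have key := integral_sq_sum_mul (P := P) (X := fun i : Fin n => W i) (c := c)
    (ξ := cellRes c y m a) (ζ := fun x => σ2 * cellInd c m x)
    (s := Finset.univ.filter (fun i : Fin n => τ i = s)) (fun i => H.measurable i)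
    (H.indep.precomp Fin.val_injective) hc hξm (hIm.const_mul σ2)
    (fun i hi => H.memLp_comp hξL (Finset.mem_filter.mp hi).2)
    (fun i hi => ((H.memLp_comp (memLp_cellInd hc m (κ s))
      (Finset.mem_filter.mp hi).2).integrable one_le_two).const_mul σ2)
    (fun i hi k => by
      rw [H.integral_comp (g := fun x => if c x = k then cellRes c y m a x else 0)
        (measurable_class_ite hc hξm k), (Finset.mem_filter.mp hi).2]
      by_cases hk : k = m
      · refine Eq.trans (integral_congr_ae (ae_of_all _ fun x => ?_)) h0
        by_cases hx : c x = m <;> simp [hk, cellRes, hx]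
      · rw [← integral_zero S ℝ]
        refine integral_congr_ae (ae_of_all _ fun x => ?_)
        by_cases hx : c x = k <;> simp [cellRes, hx, hk])
    (fun i hi k => by
      rw [H.integral_comp (g := fun x => if c x = k then cellRes c y m a x ^ 2 else 0)
        (measurable_class_ite hc (hξm.pow_const 2) k),
        H.integral_comp (g := fun x => if c x = k then σ2 * cellInd c m x else 0)
        (measurable_class_ite hc (hIm.const_mul σ2) k), (Finset.mem_filter.mp hi).2]
      by_cases hk : k = m
      · trans ∫ x, cellRes c y m a x ^ 2 ∂(κ s)
        · refine integral_congr_ae (ae_of_all _ fun x => ?_)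
          by_cases hx : c x = m <;> simp [hk, cellRes, hx]
        · rw [h1, mul_comm, ← integral_cellInd hc, ← integral_const_mul]
          refine integral_congr_ae (ae_of_all _ fun x => ?_)
          by_cases hx : c x = m <;> simp [hk, cellInd, hx]
      · refine integral_congr_ae (ae_of_all _ fun x => ?_)
        by_cases hx : c x = k <;> simp [cellRes, cellInd, hx, hk]) G
  by_cases hn : groupSize τ n s = 0
  · simp [hn, armAvg]
  have e1 : ∀ ω, armAvg τ W s (cellRes c y m a) n ω ^ 2 * G (fun i => c (W i ω))
      = (groupSize τ n s ^ 2)⁻¹ * ((∑ i ∈ Finset.univ.filter (fun i : Fin n => τ i = s),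
        cellRes c y m a (W i ω)) ^ 2 * G (fun i => c (W i ω))) := fun ω => by
    rw [armAvg, sum_armIdx_eq_sum_fin τ s n fun i => cellRes c y m a (W i ω)]
    ring
  have e2 : ∀ ω, armAvg τ W s (cellInd c m) n ω * G (fun i => c (W i ω))
      = (groupSize τ n s)⁻¹ * (∑ i ∈ Finset.univ.filter (fun i : Fin n => τ i = s),
        cellInd c m (W i ω)) * G (fun i => c (W i ω)) := fun ω => by
    rw [armAvg, sum_armIdx_eq_sum_fin τ s n fun i => cellInd c m (W i ω)]
    ring
  simp_rw [e1, e2, mul_assoc]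
  rw [integral_const_mul, integral_const_mul, key]
  simp_rw [← Finset.mul_sum, mul_assoc]
  rw [integral_const_mul]
  field_simp

end IsArmSample

end CellShares

/-! ### Linearization of one cell -/

section CellLinearization

variable {S Ω : Type*} {J : ℕ}

/-- The contribution of the cell `m` to the plug-in estimator: the cell mean in arm `t`, times the
difference of the cell shares in the arms `t` and `s`. -/
noncomputable def cellEst (τ : ℕ → Fin 2) (W : ℕ → Ω → S) (t s : Fin 2) (c : S → Fin J) (y : S → ℝ)
    (m : Fin J) (n : ℕ) (ω : Ω) : ℝ :=
  armAvg τ W t (cellRes c y m 0) n ω / armAvg τ W t (cellInd c m) n ω *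
    (armAvg τ W t (cellInd c m) n ω - armAvg τ W s (cellInd c m) n ω)

/-- The linearization of `cellEst`, where `a` is the cell mean in arm `t` and `r` the ratio of the
probabilities of the cell in the arms `s` and `t`. -/
noncomputable def cellLin (τ : ℕ → Fin 2) (W : ℕ → Ω → S) (t s : Fin 2) (c : S → Fin J) (y : S → ℝ)
    (m : Fin J) (a r : ℝ) (n : ℕ) (ω : Ω) : ℝ :=
  (1 - r) * armAvg τ W t (cellRes c y m a) n ω
    + a * (armAvg τ W t (cellInd c m) n ω - armAvg τ W s (cellInd c m) n ω)

lemma armAvg_cellRes_zero (τ : ℕ → Fin 2) (W : ℕ → Ω → S) (t : Fin 2) (c : S → Fin J) (y : S → ℝ)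
    (m : Fin J) (a : ℝ) (n : ℕ) (ω : Ω) :
    armAvg τ W t (cellRes c y m 0) n ω
      = armAvg τ W t (cellRes c y m a) n ω + a * armAvg τ W t (cellInd c m) n ω := by
  simp only [armAvg]
  rw [← mul_div_assoc, ← add_div, Finset.mul_sum, ← Finset.sum_add_distrib]
  congr 1
  refine Finset.sum_congr rfl fun i _ => ?_
  by_cases h : c (W i ω) = m <;> simp [cellRes, cellInd, h]

/-- The linearization error of a cell: a product of two centred quantities, and a contribution of
the event that the cell is nearly empty. -/
lemma sq_cellEst_sub_cellLin_le (τ : ℕ → Fin 2) (W : ℕ → Ω → S) (t s : Fin 2) (c : S → Fin J)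
    (y : S → ℝ) (m : Fin J) (a r : ℝ) {ν : ℝ} (hν : 0 < ν) {n : ℕ} (hn : 0 < groupSize τ n t)
    (ω : Ω) :
    (cellEst τ W t s c y m n ω - cellLin τ W t s c y m a r n ω) ^ 2
      ≤ armAvg τ W t (cellRes c y m a) n ω ^ 2 *
          (armAvg τ W s (cellInd c m) n ω / armAvg τ W t (cellInd c m) n ω - r) ^ 2
        + a ^ 2 * {ω | armAvg τ W t (cellInd c m) n ω < ν / 2}.indicator 1 ω := by
  have hP0 := armAvg_cellInd_nonneg τ W s c m n ω
  have hP1 := armAvg_cellInd_le_one τ W s c m n ω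
  rw [cellEst, cellLin, armAvg_cellRes_zero τ W t c y m a]
  have hind : 0 ≤ a ^ 2 *
      ({ω | armAvg τ W t (cellInd c m) n ω < ν / 2} : Set Ω).indicator (1 : Ω → ℝ) ω :=
    mul_nonneg (sq_nonneg a) (Set.indicator_nonneg (fun _ _ => zero_le_one) _)
  rcases armAvg_cellInd_eq_zero_or τ W t c m ω (n := n) with h | h
  -- an empty cell: `cellEst` is `0` by the convention `0 / 0 = 0`, and the error is the product of
  -- `a` with the share of the cell in arm `s`
  · have hp : armAvg τ W t (cellInd c m) n ω = 0 := by
      rw [armAvg, Finset.sum_eq_zero, zero_div]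
      exact fun i hi => if_neg (h i hi)
    have hZ : armAvg τ W t (cellRes c y m a) n ω = 0 := by
      rw [armAvg, Finset.sum_eq_zero, zero_div]
      exact fun i hi => if_neg (h i hi)
    have hmem : ω ∈ ({ω | armAvg τ W t (cellInd c m) n ω < ν / 2} : Set Ω) := by
      change armAvg τ W t (cellInd c m) n ω < ν / 2
      rw [hp]; positivity
    rw [Set.indicator_of_mem hmem, hp, hZ]
    simp only [Pi.one_apply, mul_one, mul_zero, add_zero, zero_add, zero_sub, zero_div, zero_mul]
    have : armAvg τ W s (cellInd c m) n ω ^ 2 ≤ 1 := by nlinarith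
    nlinarith [mul_le_mul_of_nonneg_left this (sq_nonneg a)]
  · have hp : 0 < armAvg τ W t (cellInd c m) n ω := lt_of_lt_of_le (by positivity) h
    refine le_add_of_le_of_nonneg (le_of_eq ?_) hind
    field_simp
    ring

/-- The squared error of the ratio of the two shares of a cell, weighted with the share in arm `t`.
Unless that share is below half of its expectation `ν`, the error is controlled by the errors of the
shares. Otherwise the weighted error is at most of the order of the size of the arm, because a
nonempty cell contains at least one unit. -/
lemma share_mul_sq_ratio_le (τ : ℕ → Fin 2) (W : ℕ → Ω → S) (t s : Fin 2) (c : S → Fin J)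
    (m : Fin J) {r ν ν' : ℝ} (hν : 0 < ν) (hr : 0 ≤ r) (hrν : r * ν = ν') {n : ℕ}
    (hn : 0 < groupSize τ n t) (ω : Ω) :
    armAvg τ W t (cellInd c m) n ω *
        (armAvg τ W s (cellInd c m) n ω / armAvg τ W t (cellInd c m) n ω - r) ^ 2
      ≤ 2 / ν * (2 * (armAvg τ W s (cellInd c m) n ω - ν') ^ 2
          + 2 * r ^ 2 * (armAvg τ W t (cellInd c m) n ω - ν) ^ 2)
        + groupSize τ n t * (1 + r) ^ 2 *
          {ω | armAvg τ W t (cellInd c m) n ω < ν / 2}.indicator 1 ω := by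
  have hP0 := armAvg_cellInd_nonneg τ W s c m n ω
  have hP1 := armAvg_cellInd_le_one τ W s c m n ω
  have hp0 := armAvg_cellInd_nonneg τ W t c m n ω
  have hp1 := armAvg_cellInd_le_one τ W t c m n ω
  have hor := armAvg_cellInd_eq_zero_or τ W t c m ω (n := n)
  by_cases hmem : armAvg τ W t (cellInd c m) n ω < ν / 2
  · rw [Set.indicator_of_mem (show ω ∈ {ω | armAvg τ W t (cellInd c m) n ω < ν / 2} from hmem)]
    set N := groupSize τ n t
    set p := armAvg τ W t (cellInd c m) n ω with hp
    set q := armAvg τ W s (cellInd c m) n ω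
    simp only [Pi.one_apply, mul_one]
    have hfirst : 0 ≤ 2 / ν * (2 * (q - ν') ^ 2 + 2 * r ^ 2 * (p - ν) ^ 2) := by positivity
    refine le_add_of_nonneg_of_le hfirst ?_
    rcases hor with h | h
    · have hpz : p = 0 := by
        rw [hp, armAvg, Finset.sum_eq_zero, zero_div]
        exact fun i hi => if_neg (h i hi)
      rw [hpz, zero_mul]
      positivity
    · have hp' : 0 < p := lt_of_lt_of_le (by positivity) h
      have e : p * (q / p - r) ^ 2 = (q - r * p) ^ 2 * (1 / p) := by field_simp
      rw [e]
      have h1 : 1 / p ≤ N := by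
        rw [div_le_iff₀ hp']
        rwa [div_le_iff₀ hn, mul_comm] at h
      have h2 : (q - r * p) ^ 2 ≤ (1 + r) ^ 2 := by
        refine sq_le_sq' ?_ ?_ <;> nlinarith
      calc (q - r * p) ^ 2 * (1 / p) ≤ (1 + r) ^ 2 * N :=
            mul_le_mul h2 h1 (by positivity) (by positivity)
        _ = _ := mul_comm _ _
  · rw [Set.indicator_of_notMem (show ω ∉ {ω | armAvg τ W t (cellInd c m) n ω < ν / 2} from hmem)]
    set p := armAvg τ W t (cellInd c m) n ω
    set q := armAvg τ W s (cellInd c m) n ω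
    have hp' : 0 < p := lt_of_lt_of_le (by positivity) (not_lt.mp hmem)
    have e : p * (q / p - r) ^ 2 = 1 / p * (q - r * p) ^ 2 := by field_simp
    rw [e, mul_zero, add_zero]
    have h1 : 1 / p ≤ 2 / ν := by
      rw [div_le_div_iff₀ hp' hν]
      linarith [not_lt.mp hmem]
    refine mul_le_mul h1 ?_ (sq_nonneg _) (by positivity)
    subst hrν
    nlinarith [sq_nonneg ((q - r * ν) + r * (p - ν))]

variable [MeasurableSpace S] [MeasurableSpace Ω]

namespace IsArmSample

variable {κ : Fin 2 → Measure S} {τ : ℕ → Fin 2} {P : Measure Ω} {W : ℕ → Ω → S}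
  {t s : Fin 2} {c : S → Fin J} {y : S → ℝ} {m : Fin J}

/-- The mean squared error of the share of a cell. -/
lemma integral_sq_armAvg_cellInd_sub [IsProbabilityMeasure P] [∀ s, IsProbabilityMeasure (κ s)]
    (H : IsArmSample κ τ P W) (hc : Measurable c) (s : Fin 2) (m : Fin J) {n : ℕ}
    (hn : 0 < groupSize τ n s) :
    ∫ ω, (armAvg τ W s (cellInd c m) n ω - (κ s).real {x | c x = m}) ^ 2 ∂P
      = variance (cellInd c m) (κ s) / groupSize τ n s := by
  have hIm := measurable_cellInd hc m
  have hIL := memLp_cellInd hc m (κ s)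
  rw [← H.variance_armAvg hIm hIL,
    variance_eq_integral (H.measurable_armAvg hIm n).aemeasurable,
    H.integral_armAvg hIm hIL hn.ne', integral_cellInd hc]

/-- An explicit bound for the linearization error of a cell, by a term of order `n⁻²` and an
exponentially small one. -/
lemma integral_sq_cellEst_sub_cellLin_le [IsProbabilityMeasure P]
    [∀ s, IsProbabilityMeasure (κ s)] (H : IsArmSample κ τ P W) (hc : Measurable c)
    (hy : Measurable y) (hyL : MemLp y 2 (κ t)) {a σ2 r : ℝ} (hσ : 0 ≤ σ2) (hr : 0 ≤ r)
    (hν : 0 < (κ t).real {x | c x = m})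
    (hrν : r * (κ t).real {x | c x = m} = (κ s).real {x | c x = m})
    (h0 : ∫ x, cellRes c y m a x ∂(κ t) = 0)
    (h1 : ∫ x, cellRes c y m a x ^ 2 ∂(κ t) = (κ t).real {x | c x = m} * σ2)
    {n : ℕ} (hn : 0 < groupSize τ n t) (hn' : 0 < groupSize τ n s) :
    ∫ ω, (cellEst τ W t s c y m n ω - cellLin τ W t s c y m a r n ω) ^ 2 ∂P
      ≤ σ2 / groupSize τ n t * (2 / (κ t).real {x | c x = m} *
          (2 * (variance (cellInd c m) (κ s) / groupSize τ n s)
            + 2 * r ^ 2 * (variance (cellInd c m) (κ t) / groupSize τ n t)))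
        + (σ2 * (1 + r) ^ 2 + a ^ 2) *
          Real.exp (-((κ t).real {x | c x = m} ^ 2 / 2) * groupSize τ n t) := by
  have hIm := measurable_cellInd hc m
  have htail := H.measure_cell_share_lt_le hc t m hn
  have hmse := H.integral_sq_armAvg_cellInd_sub hc t m hn
  have hmse' := H.integral_sq_armAvg_cellInd_sub hc s m hn'
  set ν := (κ t).real {x | c x = m} with hνdef
  set ν' := (κ s).real {x | c x = m} with hν'def
  set B : Set Ω := {ω | armAvg τ W t (cellInd c m) n ω < ν / 2} with hB
  have hBm : MeasurableSet B := measurableSet_lt (H.measurable_armAvg hIm n) measurable_const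
  have hBi : Integrable (B.indicator (1 : Ω → ℝ)) P := (integrable_const (1 : ℝ)).indicator hBm
  have hBint : ∫ ω, B.indicator (1 : Ω → ℝ) ω ∂P = P.real B := integral_indicator_one hBm
  -- the ratio of the shares depends on the units only through their cells
  set G : (Fin n → Fin J) → ℝ := fun v =>
    ((∑ i ∈ Finset.univ.filter (fun i : Fin n => τ i = s), if v i = m then (1 : ℝ) else 0)
        / groupSize τ n s
      / ((∑ i ∈ Finset.univ.filter (fun i : Fin n => τ i = t), if v i = m then (1 : ℝ) else 0)
        / groupSize τ n t) - r) ^ 2 with hG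
  have hGeq : ∀ ω, (armAvg τ W s (cellInd c m) n ω / armAvg τ W t (cellInd c m) n ω - r) ^ 2
      = G fun i => c (W i ω) := fun ω => by
    simp only [hG, armAvg]
    rw [sum_armIdx_eq_sum_fin τ s n fun i => cellInd c m (W i ω),
      sum_armIdx_eq_sum_fin τ t n fun i => cellInd c m (W i ω)]
    rfl
  have hGi : ∀ F : Ω → ℝ, Integrable F P → Integrable (fun ω => F ω * G fun i => c (W i ω)) P :=
    fun F hF => integrable_mul_comp_class (X := fun i : Fin n => W i)
      (fun i => H.measurable i) hc G hF
  have hZ2 : Integrable (fun ω => armAvg τ W t (cellRes c y m a) n ω ^ 2) P :=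
    (H.memLp_armAvg (memLp_cellRes hc m a hyL) n).integrable_sq
  have hIL : ∀ u, MemLp (armAvg τ W u (cellInd c m) n) 2 P := fun u =>
    H.memLp_armAvg (memLp_cellInd hc m _) n
  have hs2 : Integrable (fun ω => 2 * (armAvg τ W s (cellInd c m) n ω - ν') ^ 2) P :=
    (((hIL s).sub (memLp_const ν')).integrable_sq).const_mul 2
  have ht2 : Integrable (fun ω => 2 * r ^ 2 * (armAvg τ W t (cellInd c m) n ω - ν) ^ 2) P :=
    (((hIL t).sub (memLp_const ν)).integrable_sq).const_mul (2 * r ^ 2)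
  have hpq : Integrable (fun ω => 2 / ν * (2 * (armAvg τ W s (cellInd c m) n ω - ν') ^ 2
      + 2 * r ^ 2 * (armAvg τ W t (cellInd c m) n ω - ν) ^ 2)) P :=
    (hs2.add ht2).const_mul _
  have hstep1 : ∫ ω, (cellEst τ W t s c y m n ω - cellLin τ W t s c y m a r n ω) ^ 2 ∂P
      ≤ ∫ ω, (armAvg τ W t (cellRes c y m a) n ω ^ 2 * G (fun i => c (W i ω))
        + a ^ 2 * B.indicator 1 ω) ∂P := by
    refine integral_mono_of_nonneg (ae_of_all _ fun ω => sq_nonneg _)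
      ((hGi _ hZ2).add (hBi.const_mul _)) (ae_of_all _ fun ω => ?_)
    change _ ≤ _ * G (fun i => c (W i ω)) + _
    rw [← hGeq ω]
    exact sq_cellEst_sub_cellLin_le τ W t s c y m a r hν hn ω
  have hstep2 : ∫ ω, armAvg τ W t (cellInd c m) n ω * G (fun i => c (W i ω)) ∂P
      ≤ ∫ ω, (2 / ν * (2 * (armAvg τ W s (cellInd c m) n ω - ν') ^ 2
          + 2 * r ^ 2 * (armAvg τ W t (cellInd c m) n ω - ν) ^ 2)
        + groupSize τ n t * (1 + r) ^ 2 * B.indicator 1 ω) ∂P := by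
    refine integral_mono (hGi _ ((hIL t).integrable one_le_two))
      (hpq.add (hBi.const_mul _)) fun ω => ?_
    change armAvg τ W t (cellInd c m) n ω * G (fun i => c (W i ω)) ≤ _
    rw [← hGeq ω]
    exact share_mul_sq_ratio_le τ W t s c m hν hr hrν hn ω
  rw [integral_add (hGi _ hZ2) (hBi.const_mul _), integral_const_mul, hBint,
    H.integral_sq_armAvg_cellRes_mul hc hy hyL h0 h1] at hstep1
  rw [integral_add hpq (hBi.const_mul _), integral_const_mul, integral_const_mul, hBint,
    integral_add hs2 ht2, integral_const_mul, integral_const_mul, hmse, hmse'] at hstep2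
  have hσn : 0 ≤ σ2 / groupSize τ n t := div_nonneg hσ hn.le
  refine hstep1.trans ?_
  have h3 := mul_le_mul_of_nonneg_left hstep2 hσn
  have h4 : σ2 / groupSize τ n t * (groupSize τ n t * (1 + r) ^ 2 * P.real B)
      = σ2 * (1 + r) ^ 2 * P.real B := by field_simp
  rw [mul_add, h4] at h3
  have h5 : (σ2 * (1 + r) ^ 2 + a ^ 2) * P.real B ≤ (σ2 * (1 + r) ^ 2 + a ^ 2) *
      Real.exp (-(ν ^ 2 / 2) * groupSize τ n t) :=
    mul_le_mul_of_nonneg_left htail (by positivity)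
  linarith

/-- The linearization error of a cell is `o(n^{-1/2})` in `L²`. -/
lemma tendsto_mul_integral_sq_cellEst_sub_cellLin [IsProbabilityMeasure P]
    [∀ s, IsProbabilityMeasure (κ s)] (H : IsArmSample κ τ P W) (hc : Measurable c)
    (hy : Measurable y) (hyL : MemLp y 2 (κ t)) {a σ2 r : ℝ} (hσ : 0 ≤ σ2) (hr : 0 ≤ r)
    (hν : 0 < (κ t).real {x | c x = m})
    (hrν : r * (κ t).real {x | c x = m} = (κ s).real {x | c x = m})
    (h0 : ∫ x, cellRes c y m a x ∂(κ t) = 0)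
    (h1 : ∫ x, cellRes c y m a x ^ 2 ∂(κ t) = (κ t).real {x | c x = m} * σ2)
    {q q' : ℝ} (hq : 0 < q) (hq' : 0 < q')
    (hτ : Tendsto (fun n : ℕ => groupSize τ n t / n) atTop (𝓝 q))
    (hτ' : Tendsto (fun n : ℕ => groupSize τ n s / n) atTop (𝓝 q')) :
    Tendsto (fun n : ℕ => (n : ℝ) *
      ∫ ω, (cellEst τ W t s c y m n ω - cellLin τ W t s c y m a r n ω) ^ 2 ∂P) atTop (𝓝 0) := by
  have hinf := tendsto_groupSize_atTop hq hτ
  have hinf' := tendsto_groupSize_atTop hq' hτ'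
  set ν := (κ t).real {x | c x = m} with hνdef
  have hi : Tendsto (fun n : ℕ => variance (cellInd c m) (κ t) / groupSize τ n t) atTop (𝓝 0) :=
    hinf.const_div_atTop _
  have hi' : Tendsto (fun n : ℕ => variance (cellInd c m) (κ s) / groupSize τ n s) atTop (𝓝 0) :=
    hinf'.const_div_atTop _
  have hA := (((tendsto_div_groupSize hq hτ).const_mul σ2).mul
    (((hi'.const_mul 2).add (hi.const_mul (2 * r ^ 2))).const_mul (2 / ν))).add
    ((tendsto_mul_exp_neg_groupSize hq (by positivity : 0 < ν ^ 2 / 2) hτ).const_mul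
      (σ2 * (1 + r) ^ 2 + a ^ 2))
  simp only [mul_zero, add_zero] at hA
  refine squeeze_zero' (Eventually.of_forall fun n => mul_nonneg (Nat.cast_nonneg n)
    (integral_nonneg fun ω => sq_nonneg _)) ?_ hA
  filter_upwards [hinf.eventually_gt_atTop 0, hinf'.eventually_gt_atTop 0] with n hn hn'
  have := mul_le_mul_of_nonneg_left (H.integral_sq_cellEst_sub_cellLin_le hc hy hyL hσ hr hν hrν
    h0 h1 hn hn') (Nat.cast_nonneg (α := ℝ) n)
  refine this.trans_eq ?_
  ring

end IsArmSample

end CellLinearization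

/-! ### Linearization of the plug-in estimator -/

section EstimatorLinearization

variable {S Ω : Type*} {J : ℕ}

/-- The function that is `k m * (y - a m) + b m` on the cell `c = m`. -/
def cellwiseAffine (c : S → Fin J) (y : S → ℝ) (a k b : Fin J → ℝ) (x : S) : ℝ :=
  ∑ m, (k m * cellRes c y m (a m) x + b m * cellInd c m x)

lemma cellwiseAffine_eq (c : S → Fin J) (y : S → ℝ) (a k b : Fin J → ℝ) (x : S) :
    cellwiseAffine c y a k b x = k (c x) * (y x - a (c x)) + b (c x) := by
  rw [cellwiseAffine, Finset.sum_eq_single (c x)]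
  · simp [cellRes, cellInd]
  · intro m _ hm
    simp [cellRes, cellInd, hm.symm]
  · simp

lemma sq_cellwiseAffine (c : S → Fin J) (y : S → ℝ) (a k b : Fin J → ℝ) (x : S) :
    cellwiseAffine c y a k b x ^ 2 = ∑ m, (k m ^ 2 * cellRes c y m (a m) x ^ 2
      + 2 * k m * b m * cellRes c y m (a m) x + b m ^ 2 * cellInd c m x) := by
  rw [cellwiseAffine_eq, Finset.sum_eq_single (c x)]
  · simp only [cellRes, cellInd, if_true]
    ring
  · intro m _ hm
    simp [cellRes, cellInd, hm.symm]
  · simp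

/-- The linearizations of all cells add up to averages over the two arms. -/
lemma sum_cellLin_eq (τ : ℕ → Fin 2) (W : ℕ → Ω → S) (t s : Fin 2) (c : S → Fin J) (y : S → ℝ)
    (a r : Fin J → ℝ) (n : ℕ) (ω : Ω) :
    ∑ m, cellLin τ W t s c y m (a m) (r m) n ω
      = armAvg τ W t (cellwiseAffine c y a (fun m => 1 - r m) a) n ω
        - armAvg τ W s (cellwiseAffine c y a (fun _ => 0) a) n ω := by
  have h : ∀ u (k b : Fin J → ℝ), armAvg τ W u (cellwiseAffine c y a k b) n ω
      = ∑ m, (k m * armAvg τ W u (cellRes c y m (a m)) n ω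
        + b m * armAvg τ W u (cellInd c m) n ω) := by
    intro u k b
    simp only [armAvg, cellwiseAffine]
    rw [Finset.sum_comm, Finset.sum_div]
    refine Finset.sum_congr rfl fun m _ => ?_
    rw [Finset.sum_add_distrib, ← Finset.mul_sum, ← Finset.mul_sum]
    ring
  rw [h, h, ← Finset.sum_sub_distrib]
  refine Finset.sum_congr rfl fun m _ => ?_
  rw [cellLin]
  ring

/-- A crude bound, which makes `cellEst` square integrable: a nonempty cell has a share of at least
one unit. -/
lemma abs_cellEst_le (τ : ℕ → Fin 2) (W : ℕ → Ω → S) (t s : Fin 2) (c : S → Fin J) (y : S → ℝ)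
    (m : Fin J) (n : ℕ) (ω : Ω) :
    |cellEst τ W t s c y m n ω|
      ≤ groupSize τ n t * |armAvg τ W t (cellRes c y m 0) n ω| := by
  have hP0 := armAvg_cellInd_nonneg τ W s c m n ω
  have hP1 := armAvg_cellInd_le_one τ W s c m n ω
  have hp0 := armAvg_cellInd_nonneg τ W t c m n ω
  have hp1 := armAvg_cellInd_le_one τ W t c m n ω
  have hn := groupSize_nonneg τ n t
  rw [cellEst, abs_mul]
  have h1 : |armAvg τ W t (cellInd c m) n ω - armAvg τ W s (cellInd c m) n ω| ≤ 1 :=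
    abs_sub_le_iff.mpr ⟨by linarith, by linarith⟩
  refine (mul_le_of_le_one_right (abs_nonneg _) h1).trans ?_
  rcases armAvg_cellInd_eq_zero_or τ W t c m ω (n := n) with h | h
  · have hp : armAvg τ W t (cellInd c m) n ω = 0 := by
      rw [armAvg, Finset.sum_eq_zero, zero_div]
      exact fun i hi => if_neg (h i hi)
    rw [hp, div_zero, abs_zero]
    positivity
  · rcases hn.eq_or_lt with hn | hn
    · simp [armAvg, ← hn]
    · have hp : 0 < armAvg τ W t (cellInd c m) n ω := lt_of_lt_of_le (by positivity) h
      rw [abs_div, abs_of_pos hp, div_le_iff₀ hp]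
      rw [div_le_iff₀ hn] at h
      calc |armAvg τ W t (cellRes c y m 0) n ω| = |armAvg τ W t (cellRes c y m 0) n ω| * 1 :=
            (mul_one _).symm
        _ ≤ |armAvg τ W t (cellRes c y m 0) n ω| *
            (armAvg τ W t (cellInd c m) n ω * groupSize τ n t) :=
          mul_le_mul_of_nonneg_left h (abs_nonneg _)
        _ = _ := by ring

variable [MeasurableSpace S] [MeasurableSpace Ω]

section Moments

variable {c : S → Fin J} {y : S → ℝ} {a k b σ2 : Fin J → ℝ} {κ : Measure S}

lemma measurable_cellwiseAffine (hc : Measurable c) (hy : Measurable y) :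
    Measurable (cellwiseAffine c y a k b) :=
  Finset.measurable_fun_sum _ fun m _ => ((measurable_cellRes hc hy m (a m)).const_mul _).add
    ((measurable_cellInd hc m).const_mul _)

lemma memLp_cellwiseAffine [IsFiniteMeasure κ] (hc : Measurable c) (hy : MemLp y 2 κ) :
    MemLp (cellwiseAffine c y a k b) 2 κ :=
  memLp_finsetSum _ fun m _ => ((memLp_cellRes hc m (a m) hy).const_mul _).add
    ((memLp_cellInd hc m κ).const_mul _)

lemma integral_cellwiseAffine [IsFiniteMeasure κ] (hc : Measurable c) (hy : MemLp y 2 κ)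
    (h0 : ∀ m, ∫ x, cellRes c y m (a m) x ∂κ = 0) :
    ∫ x, cellwiseAffine c y a k b x ∂κ = ∑ m, b m * κ.real {x | c x = m} := by
  have hR : ∀ m, Integrable (fun x => k m * cellRes c y m (a m) x) κ := fun m =>
    ((memLp_cellRes hc m (a m) hy).integrable one_le_two).const_mul _
  have hI : ∀ m, Integrable (fun x => b m * cellInd c m x) κ := fun m =>
    ((memLp_cellInd hc m κ).integrable one_le_two).const_mul _
  simp only [cellwiseAffine]
  rw [integral_finsetSum (f := fun m x => k m * cellRes c y m (a m) x + b m * cellInd c m x) _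
    fun m _ => (hR m).add (hI m)]
  refine Finset.sum_congr rfl fun m _ => ?_
  rw [integral_add (hR m) (hI m), integral_const_mul, integral_const_mul, h0, integral_cellInd hc]
  ring

/-- The decomposition of the variance into a part within and a part between the cells. -/
lemma variance_cellwiseAffine [IsProbabilityMeasure κ] (hc : Measurable c) (hy : MemLp y 2 κ)
    (h0 : ∀ m, ∫ x, cellRes c y m (a m) x ∂κ = 0)
    (h1 : ∀ m, ∫ x, cellRes c y m (a m) x ^ 2 ∂κ = κ.real {x | c x = m} * σ2 m) :
    variance (cellwiseAffine c y a k b) κ = ∑ m, k m ^ 2 * (κ.real {x | c x = m} * σ2 m)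
      + (∑ m, b m ^ 2 * κ.real {x | c x = m} - (∑ m, b m * κ.real {x | c x = m}) ^ 2) := by
  have hRL : ∀ m, MemLp (cellRes c y m (a m)) 2 κ := fun m => memLp_cellRes hc m (a m) hy
  have hR2 : ∀ m, Integrable (fun x => k m ^ 2 * cellRes c y m (a m) x ^ 2) κ := fun m =>
    (hRL m).integrable_sq.const_mul _
  have hR : ∀ m, Integrable (fun x => 2 * k m * b m * cellRes c y m (a m) x) κ := fun m =>
    ((hRL m).integrable one_le_two).const_mul _
  have hI : ∀ m, Integrable (fun x => b m ^ 2 * cellInd c m x) κ := fun m =>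
    ((memLp_cellInd hc m κ).integrable one_le_two).const_mul _
  rw [variance_eq_sub (memLp_cellwiseAffine hc hy), integral_cellwiseAffine hc hy h0]
  have : ∫ x, cellwiseAffine c y a k b x ^ 2 ∂κ = ∑ m, k m ^ 2 * (κ.real {x | c x = m} * σ2 m)
      + ∑ m, b m ^ 2 * κ.real {x | c x = m} := by
    simp only [sq_cellwiseAffine]
    rw [integral_finsetSum (f := fun m x => k m ^ 2 * cellRes c y m (a m) x ^ 2
      + 2 * k m * b m * cellRes c y m (a m) x + b m ^ 2 * cellInd c m x) _
      fun m _ => ((hR2 m).add (hR m)).add (hI m), ← Finset.sum_add_distrib]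
    refine Finset.sum_congr rfl fun m _ => ?_
    have e1 := integral_add ((hR2 m).add (hR m)) (hI m)
    have e2 := integral_add (hR2 m) (hR m)
    simp only [Pi.add_apply] at e1
    rw [e1, e2, integral_const_mul, integral_const_mul, integral_const_mul, h0, h1,
      integral_cellInd hc]
    ring
  simp only [Pi.pow_apply]
  rw [this]
  ring

/-- Residuals are centred, if the centre is the mean given the cell. -/
lemma integral_cellRes_cond [IsProbabilityMeasure κ] (hc : Measurable c) (hy : Integrable y κ)
    (m : Fin J) (hν : 0 < κ.real {x | c x = m}) :
    ∫ x, cellRes c y m (∫ x, y x ∂(cond κ {x | c x = m})) x ∂κ = 0 := by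
  rw [cellRes_eq_indicator, integral_indicator (hc (measurableSet_singleton m)),
    integral_sub hy.integrableOn (integrable_const _), setIntegral_const, ProbabilityTheory.cond,
    integral_smul_measure]
  change ∫ x in {x | c x = m}, y x ∂κ - κ.real {x | c x = m} • _ = 0
  rw [ENNReal.toReal_inv, smul_smul]
  change _ - (κ.real {x | c x = m} * (κ.real {x | c x = m})⁻¹) • _ = 0
  rw [mul_inv_cancel₀ hν.ne', one_smul, sub_self]

lemma integral_sq_cellRes_cond [IsProbabilityMeasure κ] (hc : Measurable c) (hym : Measurable y)
    (m : Fin J) (hν : 0 < κ.real {x | c x = m}) :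
    ∫ x, cellRes c y m (∫ x, y x ∂(cond κ {x | c x = m})) x ^ 2 ∂κ
      = κ.real {x | c x = m} * variance y (cond κ {x | c x = m}) := by
  set a := ∫ x, y x ∂(cond κ {x | c x = m}) with ha
  have hsq : (fun x => cellRes c y m a x ^ 2)
      = (c ⁻¹' {m}).indicator fun x => (y x - a) ^ 2 := by
    ext x
    by_cases h : c x = m <;> simp [cellRes, h]
  rw [hsq, integral_indicator (hc (measurableSet_singleton m)), variance_eq_integral
    hym.aemeasurable, ← ha, ProbabilityTheory.cond, integral_smul_measure, smul_eq_mul,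
    ENNReal.toReal_inv]
  change _ = κ.real {x | c x = m} * ((κ.real {x | c x = m})⁻¹ * _)
  rw [← mul_assoc, mul_inv_cancel₀ hν.ne', one_mul]
  rfl

end Moments

namespace IsArmSample

variable {κ : Fin 2 → Measure S} {τ : ℕ → Fin 2} {P : Measure Ω} {W : ℕ → Ω → S}
  {t s : Fin 2} {c : S → Fin J} {y : S → ℝ}

lemma memLp_cellEst (H : IsArmSample κ τ P W) [∀ s, IsProbabilityMeasure (κ s)]
    (hc : Measurable c) (hym : Measurable y) (hy : MemLp y 2 (κ t)) (m : Fin J) (n : ℕ) :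
    MemLp (cellEst τ W t s c y m n) 2 P := by
  have hIm := measurable_cellInd hc m
  have hL := H.memLp_armAvg (memLp_cellRes hc m 0 hy) n
  refine (hL.const_mul (groupSize τ n t)).mono ?_ (ae_of_all _ fun ω => ?_)
  · exact (((H.measurable_armAvg (measurable_cellRes hc hym m 0) n).div
      (H.measurable_armAvg hIm n)).mul
      ((H.measurable_armAvg hIm n).sub (H.measurable_armAvg hIm n))).aestronglyMeasurable
  · rw [Real.norm_eq_abs, norm_mul, Real.norm_eq_abs, Real.norm_eq_abs,
      abs_of_nonneg (groupSize_nonneg τ n t)]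
    exact abs_cellEst_le τ W t s c y m n ω

/-- The plug-in estimator is linear up to an error of order `o(n^{-1/2})` in `L²`. -/
lemma tendsto_mul_integral_sq_sum_cellEst_sub [IsProbabilityMeasure P]
    [∀ s, IsProbabilityMeasure (κ s)] (H : IsArmSample κ τ P W) (hc : Measurable c)
    (hy : Measurable y) (hyL : MemLp y 2 (κ t)) {a σ2 r : Fin J → ℝ} (hσ : ∀ m, 0 ≤ σ2 m)
    (hr : ∀ m, 0 ≤ r m) (hν : ∀ m, 0 < (κ t).real {x | c x = m})
    (hrν : ∀ m, r m * (κ t).real {x | c x = m} = (κ s).real {x | c x = m})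
    (h0 : ∀ m, ∫ x, cellRes c y m (a m) x ∂(κ t) = 0)
    (h1 : ∀ m, ∫ x, cellRes c y m (a m) x ^ 2 ∂(κ t) = (κ t).real {x | c x = m} * σ2 m)
    {q q' : ℝ} (hq : 0 < q) (hq' : 0 < q')
    (hτ : Tendsto (fun n : ℕ => groupSize τ n t / n) atTop (𝓝 q))
    (hτ' : Tendsto (fun n : ℕ => groupSize τ n s / n) atTop (𝓝 q')) :
    Tendsto (fun n : ℕ => (n : ℝ) * ∫ ω, (∑ m, cellEst τ W t s c y m n ω
        - (armAvg τ W t (cellwiseAffine c y a (fun m => 1 - r m) a) n ω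
        - armAvg τ W s (cellwiseAffine c (fun _ => 0) (fun _ => 0) (fun _ => 0) a) n ω)) ^ 2 ∂P)
      atTop (𝓝 0) := by
  -- in arm `s` the residuals have coefficient `0`, so that the outcome does not matter there
  have hψ : cellwiseAffine c (fun _ => 0) (fun _ => 0) (fun _ => 0) a
      = cellwiseAffine c y a (fun _ => 0) a := by
    ext x
    simp [cellwiseAffine_eq]
  rw [hψ]
  have hlin : ∀ m n, MemLp (cellLin τ W t s c y m (a m) (r m) n) 2 P := fun m n =>
    ((H.memLp_armAvg (memLp_cellRes hc m (a m) hyL) n).const_mul _).add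
      (((H.memLp_armAvg (memLp_cellInd hc m _) n).sub
        (H.memLp_armAvg (memLp_cellInd hc m _) n)).const_mul _)
  have hsum := (tendsto_finsetSum Finset.univ fun m _ =>
    H.tendsto_mul_integral_sq_cellEst_sub_cellLin hc hy hyL (hσ m) (hr m) (hν m) (hrν m)
      (h0 m) (h1 m) hq hq' hτ hτ').const_mul (J : ℝ)
  simp only [Finset.sum_const_zero, mul_zero] at hsum
  refine squeeze_zero (fun n => mul_nonneg (Nat.cast_nonneg n)
    (integral_nonneg fun ω => sq_nonneg _)) (fun n => ?_) hsum
  have hint : ∀ m, Integrable (fun ω =>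
      (cellEst τ W t s c y m n ω - cellLin τ W t s c y m (a m) (r m) n ω) ^ 2) P := fun m =>
    ((H.memLp_cellEst hc hy hyL m n).sub (hlin m n)).integrable_sq
  have hle : ∫ ω, (∑ m, cellEst τ W t s c y m n ω
        - (armAvg τ W t (cellwiseAffine c y a (fun m => 1 - r m) a) n ω
        - armAvg τ W s (cellwiseAffine c y a (fun _ => 0) a) n ω)) ^ 2 ∂P
      ≤ ∫ ω, J * ∑ m, (cellEst τ W t s c y m n ω
        - cellLin τ W t s c y m (a m) (r m) n ω) ^ 2 ∂P := by
    refine integral_mono_of_nonneg (ae_of_all _ fun ω => sq_nonneg _)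
      ((integrable_finsetSum _ fun m _ => hint m).const_mul _) (ae_of_all _ fun ω => ?_)
    simp only
    rw [← sum_cellLin_eq, ← Finset.sum_sub_distrib]
    have := sq_sum_le_card_mul_sum_sq (s := Finset.univ) (f := fun m : Fin J =>
      cellEst τ W t s c y m n ω - cellLin τ W t s c y m (a m) (r m) n ω)
    simpa using this
  rw [integral_const_mul, integral_finsetSum _ fun m _ => hint m] at hle
  refine (mul_le_mul_of_nonneg_left hle (Nat.cast_nonneg n)).trans_eq ?_
  rw [Finset.mul_sum, Finset.mul_sum, Finset.mul_sum]
  exact Finset.sum_congr rfl fun m _ => by ring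

end IsArmSample

end EstimatorLinearization

/-! ### Population quantities and the variance formula -/

section VarianceFormula

variable {J : ℕ} {𝒳 : Type*}

lemma sq_sum_eq_sum_sq_add_two_mul (x : Fin J → ℝ) :
    (∑ m, x m) ^ 2 = ∑ m, x m ^ 2 + 2 * ∑ m, ∑ m' ∈ Finset.Ioi m, x m * x m' := by
  have h := Finset.sum_sum_Ioi_add_eq_sum_sum_off_diag fun i j => x i * x j
  have h2 : ∀ i, ∑ j ∈ ({i}ᶜ : Finset (Fin J)), x j * x i = (∑ j, x j) * x i - x i ^ 2 := by
    intro i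
    rw [Finset.sum_mul, ← Finset.sum_compl_add_sum {i}]
    simp [pow_two]
  simp_rw [h2, Finset.sum_sub_distrib, ← Finset.mul_sum] at h
  have h3 : ∑ m, ∑ m' ∈ Finset.Ioi m, (x m' * x m + x m * x m')
      = 2 * ∑ m, ∑ m' ∈ Finset.Ioi m, x m * x m' := by
    simp_rw [Finset.mul_sum]
    exact Finset.sum_congr rfl fun m _ => Finset.sum_congr rfl fun m' _ => by ring
  rw [h3] at h
  rw [h]
  ring

/-- An event whose conditional probability is almost surely positive has positive probability. -/
lemma pos_of_condProb_pos {Ω : Type*} {m m0 : MeasurableSpace Ω} {μ : Measure Ω}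
    [IsProbabilityMeasure μ] {A : Set Ω} (h : ∀ᵐ ω ∂μ, 0 < (μ⟦A|m⟧) ω) : 0 < μ.real A := by
  refine lt_of_le_of_ne measureReal_nonneg fun h0 => ?_
  have hz : A.indicator (fun _ => (1 : ℝ)) =ᵐ[μ] 0 := by
    have hA0 : μ A = 0 := by
      rwa [eq_comm, measureReal_eq_zero_iff] at h0
    exact indicator_meas_zero hA0
  have hc : μ⟦A|m⟧ =ᵐ[μ] 0 := (condExp_congr_ae hz).trans (by rw [condExp_zero])
  obtain ⟨ω, h1, h2⟩ := (h.and hc).exists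
  rw [h2] at h1
  exact lt_irrefl _ h1

section Population

variable [MeasurableSpace 𝒳]

lemma measurable_treat : Measurable (treat : UnitData J 𝒳 → Fin 2) := measurable_fst

lemma measurable_potMed (t : Fin 2) : Measurable (potMed t : UnitData J 𝒳 → Fin J) :=
  (measurable_pi_apply t).comp (measurable_fst.comp (measurable_snd.comp measurable_snd))

lemma measurable_potOut (t : Fin 2) (m : Fin J) : Measurable (potOut t m : UnitData J 𝒳 → ℝ) :=
  (measurable_pi_apply m).comp ((measurable_pi_apply t).comp
    (measurable_snd.comp (measurable_snd.comp measurable_snd)))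

lemma measurable_obsMed : Measurable (obsMed : UnitData J 𝒳 → Fin J) := by
  have : Measurable fun p : Fin 2 × UnitData J 𝒳 => potMed p.1 p.2 :=
    measurable_from_prod_countable_right fun t => measurable_potMed t
  exact this.comp (measurable_treat.prodMk measurable_id)

lemma measurable_obsOut : Measurable (obsOut : UnitData J 𝒳 → ℝ) := by
  have : Measurable fun p : (Fin 2 × Fin J) × UnitData J 𝒳 => potOut p.1.1 p.1.2 p.2 :=
    measurable_from_prod_countable_right fun p => measurable_potOut p.1 p.2
  exact this.comp ((measurable_treat.prodMk measurable_obsMed).prodMk measurable_id)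

lemma measurableSet_treat (s : Fin 2) : MeasurableSet {u : UnitData J 𝒳 | treat u = s} :=
  measurable_treat (measurableSet_singleton s)

lemma measurableSet_obsMed (m : Fin J) : MeasurableSet {u : UnitData J 𝒳 | obsMed u = m} :=
  measurable_obsMed (measurableSet_singleton m)

/-- The law of a unit of the population `Q`, given that its treatment is `s`. -/
noncomputable abbrev armLaw (Q : Measure (UnitData J 𝒳)) (s : Fin 2) : Measure (UnitData J 𝒳) :=
  cond Q {u | treat u = s}

/-- The influence function of the units with treatment `t`, for the estimator up to its sign. Its
value at a unit with `M = m` is `(1 - ν_{1-t,m} / ν_{tm}) (Y - μ_{tm}) + μ_{tm}`. -/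
noncomputable def influenceSelf (Q : Measure (UnitData J 𝒳)) (t : Fin 2) : UnitData J 𝒳 → ℝ :=
  cellwiseAffine obsMed obsOut (mu Q t) (fun m => 1 - nu Q (1 - t) m / nu Q t m) (mu Q t)

/-- The influence function, up to the sign, of the units with treatment `1 - t`. Its value at a unit
with `M = m` is `μ_{tm}`; the outcomes of these units do not enter the estimator. -/
noncomputable def influenceOther (Q : Measure (UnitData J 𝒳)) (t : Fin 2) : UnitData J 𝒳 → ℝ :=
  cellwiseAffine obsMed (fun _ => 0) (fun _ => 0) (fun _ => 0) (mu Q t)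

variable {Q : Measure (UnitData J 𝒳)} {t : Fin 2}

lemma nu_eq (t : Fin 2) (m : Fin J) : nu Q t m = (armLaw Q t).real {u | potMed t u = m} := by
  refine measureReal_congr ?_
  filter_upwards [ae_cond_mem (μ := Q) (measurableSet_treat t)] with u hu
  have hu' : treat u = t := hu
  change (obsMed u = m) = (potMed t u = m)
  rw [obsMed, hu']

lemma cond_obsMed_eq (Q : Measure (UnitData J 𝒳)) [IsProbabilityMeasure Q] (t : Fin 2)
    (m : Fin J) :
    cond Q {u | obsMed u = m ∧ treat u = t} = cond (armLaw Q t) {u | obsMed u = m} := by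
  rw [armLaw, cond_cond_eq_cond_inter (measurableSet_treat t) (measurableSet_obsMed m)]
  congr 1
  ext u
  exact and_comm

lemma memLp_obsOut_armLaw (hY : MemLp obsOut 2 Q) (s : Fin 2) (hs : Q {u | treat u = s} ≠ 0) :
    MemLp obsOut 2 (armLaw Q s) :=
  (hY.restrict _).smul_measure (ENNReal.inv_ne_top.mpr hs)

lemma variance_influenceOther [IsProbabilityMeasure (armLaw Q (1 - t))] :
    variance (influenceOther Q t) (armLaw Q (1 - t))
      = ∑ m, nu Q (1 - t) m * (1 - nu Q (1 - t) m) * mu Q t m ^ 2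
        - 2 * ∑ m, ∑ m' ∈ Finset.Ioi m,
          nu Q (1 - t) m * nu Q (1 - t) m' * mu Q t m * mu Q t m' := by
  have h0 : ∀ m, ∫ u, cellRes (obsMed : UnitData J 𝒳 → Fin J) (fun _ => (0 : ℝ)) m 0 u
      ∂(armLaw Q (1 - t)) = 0 := fun m => by simp [cellRes]
  have h1 : ∀ m, ∫ u, cellRes (obsMed : UnitData J 𝒳 → Fin J) (fun _ => (0 : ℝ)) m 0 u ^ 2
      ∂(armLaw Q (1 - t)) = (armLaw Q (1 - t)).real {u | obsMed u = m} * 0 :=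
    fun m => by simp [cellRes]
  rw [influenceOther, variance_cellwiseAffine (σ2 := fun _ => 0) measurable_obsMed
    (memLp_const 0) h0 h1, sq_sum_eq_sum_sq_add_two_mul]
  change _ + (∑ m, mu Q t m ^ 2 * nu Q (1 - t) m - (∑ m, (mu Q t m * nu Q (1 - t) m) ^ 2
    + 2 * ∑ m, ∑ m' ∈ Finset.Ioi m, mu Q t m * nu Q (1 - t) m
      * (mu Q t m' * nu Q (1 - t) m'))) = _
  have e : ∀ m m', mu Q t m * nu Q (1 - t) m * (mu Q t m' * nu Q (1 - t) m')
      = nu Q (1 - t) m * nu Q (1 - t) m' * mu Q t m * mu Q t m' := fun m m' => by ring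
  simp_rw [e]
  rw [← sub_sub, ← Finset.sum_sub_distrib, ← add_sub_assoc, ← Finset.sum_add_distrib]
  congr 1
  exact Finset.sum_congr rfl fun m _ => by ring

lemma integral_influenceOther [IsProbabilityMeasure (armLaw Q (1 - t))] :
    ∫ u, influenceOther Q t u ∂(armLaw Q (1 - t)) = ∑ m, mu Q t m * nu Q (1 - t) m :=
  integral_cellwiseAffine measurable_obsMed (memLp_const 0) fun m => by simp [cellRes]

variable [IsProbabilityMeasure Q]

lemma mu_eq (t : Fin 2) (m : Fin J) :
    mu Q t m = ∫ u, obsOut u ∂(cond (armLaw Q t) {u | obsMed u = m}) := by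
  rw [mu, cond_obsMed_eq]

lemma cellVar_eq (t : Fin 2) (m : Fin J) :
    cellVar Q t m = variance obsOut (cond (armLaw Q t) {u | obsMed u = m}) := by
  rw [cellVar, cond_obsMed_eq]

lemma integral_cellRes_mu [IsProbabilityMeasure (armLaw Q t)]
    (hY : MemLp obsOut 2 (armLaw Q t)) {m : Fin J} (hν : 0 < nu Q t m) :
    ∫ u, cellRes obsMed obsOut m (mu Q t m) u ∂(armLaw Q t) = 0 := by
  rw [mu_eq]
  exact integral_cellRes_cond measurable_obsMed (hY.integrable one_le_two) m hν

lemma integral_sq_cellRes_mu [IsProbabilityMeasure (armLaw Q t)] {m : Fin J}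
    (hν : 0 < nu Q t m) :
    ∫ u, cellRes obsMed obsOut m (mu Q t m) u ^ 2 ∂(armLaw Q t) = nu Q t m * cellVar Q t m := by
  rw [mu_eq, cellVar_eq]
  exact integral_sq_cellRes_cond measurable_obsMed measurable_obsOut m hν

lemma variance_influenceSelf [IsProbabilityMeasure (armLaw Q t)]
    (hY : MemLp obsOut 2 (armLaw Q t)) (hν : ∀ m, 0 < nu Q t m) :
    variance (influenceSelf Q t) (armLaw Q t)
      = ∑ m, nu Q (1 - t) m * (nu Q (1 - t) m / nu Q t m - 2) * cellVar Q t m + armVar Q t := by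
  have h0 := fun m => integral_cellRes_mu hY (hν m)
  have h1 := fun m => integral_sq_cellRes_mu (hν m)
  -- the outcome itself has the same form, with slope `1` in each cell
  have hy : (obsOut : UnitData J 𝒳 → ℝ)
      = cellwiseAffine obsMed obsOut (mu Q t) (fun _ => 1) (mu Q t) := by
    ext u
    rw [cellwiseAffine_eq]
    ring
  have hV : armVar Q t = _ := (congrArg (fun f => variance f (armLaw Q t)) hy).trans
    (variance_cellwiseAffine measurable_obsMed hY h0 h1)
  rw [hV, influenceSelf, variance_cellwiseAffine measurable_obsMed hY h0 h1, ← add_assoc,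
    ← Finset.sum_add_distrib]
  congr 1
  refine Finset.sum_congr rfl fun m _ => ?_
  change (1 - nu Q (1 - t) m / nu Q t m) ^ 2 * (nu Q t m * cellVar Q t m)
    = _ + 1 ^ 2 * (nu Q t m * cellVar Q t m)
  have := (hν m).ne'
  field_simp
  ring

lemma integral_influenceSelf [IsProbabilityMeasure (armLaw Q t)]
    (hY : MemLp obsOut 2 (armLaw Q t)) (hν : ∀ m, 0 < nu Q t m) :
    ∫ u, influenceSelf Q t u ∂(armLaw Q t) = ∑ m, mu Q t m * nu Q t m :=
  integral_cellwiseAffine measurable_obsMed hY fun m => integral_cellRes_mu hY (hν m)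

/-- The variance formula is the variance of the linearized estimator: each arm contributes the
variance of its influence function, divided by the number of units. -/
lemma varFormula_eq [∀ s, IsProbabilityMeasure (armLaw Q s)]
    (hY : MemLp obsOut 2 (armLaw Q t)) (hν : ∀ m, 0 < nu Q t m) {a : ℝ} (ha : a ≠ 0) (b : ℝ) :
    varFormula Q t a b = variance (influenceSelf Q t) (armLaw Q t) / a
      + variance (influenceOther Q t) (armLaw Q (1 - t)) / b := by
  rw [variance_influenceSelf hY hν, variance_influenceOther, varFormula]
  have e : ∑ m : Fin J, nu Q (1 - t) m * ((nu Q (1 - t) m / nu Q t m - 2) * cellVar Q t m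
        + a * (1 - nu Q (1 - t) m) * mu Q t m ^ 2 / b)
      = ∑ m, nu Q (1 - t) m * (nu Q (1 - t) m / nu Q t m - 2) * cellVar Q t m
        + a * (∑ m, nu Q (1 - t) m * (1 - nu Q (1 - t) m) * mu Q t m ^ 2) / b := by
    rw [mul_div_assoc, Finset.sum_div, Finset.mul_sum, ← Finset.sum_add_distrib]
    exact Finset.sum_congr rfl fun m _ => by ring
  rw [e]
  field_simp
  ring

end Population

namespace SequentialIgnorability

variable [MeasurableSpace 𝒳] [StandardBorelSpace 𝒳] {Q : Measure (UnitData J 𝒳)}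
  [IsProbabilityMeasure Q]

lemma treat_pos (hQ : SequentialIgnorability Q) (s : Fin 2) : 0 < Q.real {u | treat u = s} :=
  pos_of_condProb_pos (hQ.treatment_pos s)

lemma measure_treat_ne_zero (hQ : SequentialIgnorability Q) (s : Fin 2) :
    Q {u | treat u = s} ≠ 0 := fun h =>
  (hQ.treat_pos s).ne' (by rw [measureReal_def, h, ENNReal.toReal_zero])

lemma isProbabilityMeasure_armLaw (hQ : SequentialIgnorability Q) (s : Fin 2) :
    IsProbabilityMeasure (armLaw Q s) :=
  cond_isProbabilityMeasure (hQ.measure_treat_ne_zero s)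

lemma nu_pos (hQ : SequentialIgnorability Q) (t : Fin 2) (m : Fin J) : 0 < nu Q t m := by
  have := hQ.isProbabilityMeasure_armLaw t
  rw [nu_eq]
  exact pos_of_condProb_pos (hQ.mediator_pos t m)

end SequentialIgnorability

end VarianceFormula

/-! ### The conditional law given the treatments -/

section ConditionalLaw

section CondProduct

variable {ι S Ω : Type*} [Fintype ι] [MeasurableSpace S] [MeasurableSpace Ω]

lemma map_cond_preimage {P : Measure Ω} {R : Ω → S} (hR : Measurable R) {E : Set S}
    (hE : MeasurableSet E) : (cond P (R ⁻¹' E)).map R = cond (P.map R) E := by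
  ext A hA
  rw [Measure.map_apply hR hA, cond_apply (hR hE), cond_apply hE, Measure.map_apply hR hE,
    Measure.map_apply hR (hE.inter hA), Set.preimage_inter]

/-- Conditioning a product measure on a product set conditions each factor. -/
lemma cond_pi (μ : ι → Measure S) [∀ i, IsProbabilityMeasure (μ i)] {A : ι → Set S}
    (hA : ∀ i, MeasurableSet (A i)) :
    cond (Measure.pi μ) (Set.univ.pi A) = Measure.pi fun i => cond (μ i) (A i) := by
  symm
  refine Measure.pi_eq fun s hs => ?_
  rw [cond_apply (MeasurableSet.univ_pi hA), ← Set.pi_inter_distrib, Measure.pi_pi, Measure.pi_pi,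
    ENNReal.prod_inv_distrib fun i _ j _ _ => Or.inr (measure_ne_top _ _),
    ← Finset.prod_mul_distrib]
  exact Finset.prod_congr rfl fun i _ => (cond_apply (hA i) _ _).symm

end CondProduct

variable {J : ℕ} {𝒳 : Type*}

lemma deltaHat_congr {u v : ℕ → UnitData J 𝒳} {n : ℕ} (h : ∀ i < n, u i = v i) (t : Fin 2) :
    deltaHat u n t = deltaHat v n t := by
  have hs : ∀ (f : UnitData J 𝒳 → ℝ),
      ∑ i ∈ Finset.range n, f (u i) = ∑ i ∈ Finset.range n, f (v i) := fun f =>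
    Finset.sum_congr rfl fun i hi => by rw [h i (Finset.mem_range.mp hi)]
  have h1 : ∀ s, groupSize (fun i => treat (u i)) n s = groupSize (fun i => treat (v i)) n s :=
    fun s => hs fun x => if treat x = s then 1 else 0
  have h2 : ∀ s m, cellSize u n s m = cellSize v n s m :=
    fun s m => hs fun x => if treat x = s ∧ obsMed x = m then 1 else 0
  have h3 : ∀ s m, cellSum u n s m = cellSum v n s m :=
    fun s m => hs fun x => if treat x = s ∧ obsMed x = m then obsOut x else 0
  simp only [deltaHat, h1, h2, h3]

/-- In terms of averages over the arms, the plug-in estimator is, up to a sign, a sum over the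
cells. -/
lemma deltaHat_eq_sum_cellEst {τ : ℕ → Fin 2} {u : ℕ → UnitData J 𝒳} (h : ∀ i, treat (u i) = τ i)
    (n : ℕ) (t : Fin 2) :
    deltaHat u n t = (if t = 1 then 1 else -1) *
      ∑ m, cellEst τ (fun i v => v i) t (1 - t) obsMed obsOut m n u := by
  have hg : groupSize (fun i => treat (u i)) = groupSize τ := by simp only [h]
  have hN : ∀ s m, cellSize u n s m
      = groupSize τ n s * armAvg τ (fun i v => v i) s (cellInd obsMed m) n u := by
    intro s m
    rw [cellSize, armAvg, mul_div_cancel_of_imp', armIdx, Finset.sum_filter]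
    · refine Finset.sum_congr rfl fun i _ => ?_
      simp only [h, cellInd]
      exact ite_and _ _ _ _
    · intro hz
      rw [groupSize_eq_card, Nat.cast_eq_zero, Finset.card_eq_zero] at hz
      rw [hz, Finset.sum_empty]
  have hS : ∀ s m, cellSum u n s m
      = groupSize τ n s * armAvg τ (fun i v => v i) s (cellRes obsMed obsOut m 0) n u := by
    intro s m
    rw [cellSum, armAvg, mul_div_cancel_of_imp', armIdx, Finset.sum_filter]
    · refine Finset.sum_congr rfl fun i _ => ?_
      simp only [h, cellRes, sub_zero]
      exact ite_and _ _ _ _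
    · intro hz
      rw [groupSize_eq_card, Nat.cast_eq_zero, Finset.card_eq_zero] at hz
      rw [hz, Finset.sum_empty]
  have hp : ∀ s m, 1 / groupSize τ n s * cellSize u n s m
      = armAvg τ (fun i v => v i) s (cellInd obsMed m) n u := by
    intro s m
    by_cases hz : groupSize τ n s = 0
    · simp [hz, armAvg]
    · rw [hN]; field_simp
  have hr : ∀ m, cellSum u n t m / cellSize u n t m
      = armAvg τ (fun i v => v i) t (cellRes obsMed obsOut m 0) n u
        / armAvg τ (fun i v => v i) t (cellInd obsMed m) n u := by
    intro m
    rw [hS, hN]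
    by_cases hz : groupSize τ n t = 0
    · simp [hz, armAvg]
    · exact mul_div_mul_left _ _ hz
  rw [deltaHat, hg, Finset.mul_sum]
  refine Finset.sum_congr rfl fun m _ => ?_
  rw [hp, hp, hr, cellEst]
  fin_cases t
  · simp only [Fin.zero_eta, zero_ne_one, if_false, sub_zero]
    ring
  · simp

section Transfer

variable [MeasurableSpace 𝒳]

lemma measurable_deltaHat (n : ℕ) (t : Fin 2) :
    Measurable fun u : ℕ → UnitData J 𝒳 => deltaHat u n t := by
  have hs : ∀ (f : UnitData J 𝒳 → ℝ), Measurable f →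
      Measurable fun u : ℕ → UnitData J 𝒳 => ∑ i ∈ Finset.range n, f (u i) := fun f hf =>
    Finset.measurable_fun_sum _ fun i _ => hf.comp (measurable_pi_apply i)
  have h1 : ∀ s, Measurable fun u : ℕ → UnitData J 𝒳 => groupSize (fun i => treat (u i)) n s :=
    fun s => hs (fun x => if treat x = s then 1 else 0)
      (Measurable.ite (measurableSet_treat s) measurable_const measurable_const)
  have h2 : ∀ s m, Measurable fun u : ℕ → UnitData J 𝒳 => cellSize u n s m :=
    fun s m => hs (fun x => if treat x = s ∧ obsMed x = m then 1 else 0)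
      (Measurable.ite ((measurableSet_treat s).inter (measurableSet_obsMed m))
        measurable_const measurable_const)
  have h3 : ∀ s m, Measurable fun u : ℕ → UnitData J 𝒳 => cellSum u n s m :=
    fun s m => hs (fun x => if treat x = s ∧ obsMed x = m then obsOut x else 0)
      (Measurable.ite ((measurableSet_treat s).inter (measurableSet_obsMed m))
        measurable_obsOut measurable_const)
  exact Finset.measurable_fun_sum _ fun m _ => ((h3 t m).div (h2 t m)).mul
    ((((h1 1).const_div 1).mul (h2 1 m)).sub (((h1 0).const_div 1).mul (h2 0 m)))

/-- The proportion of each treatment group converges almost surely. -/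
lemma ae_tendsto_groupSize {Q : Measure (UnitData J 𝒳)} [IsProbabilityMeasure Q]
    {Ω : Type*} [MeasurableSpace Ω] {P : Measure Ω} {U : ℕ → Ω → UnitData J 𝒳}
    (hU : ∀ i, Measurable (U i)) (hind : iIndepFun U P) (hlaw : ∀ i, P.map (U i) = Q) :
    ∀ᵐ ω ∂P, ∀ s : Fin 2, Tendsto
      (fun n : ℕ => groupSize (fun i => treat (U i ω)) n s / n) atTop
      (𝓝 (Q.real {u | treat u = s})) := by
  refine ae_all_iff.mpr fun s => ?_
  have hf : Measurable ({u : UnitData J 𝒳 | treat u = s}.indicator (1 : UnitData J 𝒳 → ℝ)) :=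
    measurable_one.indicator (measurableSet_treat s)
  have hfe : ∀ u : UnitData J 𝒳, {u : UnitData J 𝒳 | treat u = s}.indicator
      (1 : UnitData J 𝒳 → ℝ) u = if treat u = s then 1 else 0 := fun u => by
    by_cases h : treat u = s <;> simp [h]
  have hI : Integrable ({u : UnitData J 𝒳 | treat u = s}.indicator (1 : UnitData J 𝒳 → ℝ)) Q :=
    (integrable_const (1 : ℝ)).indicator (measurableSet_treat s)
  have h := strong_law_ae_real (μ := P)
    (fun i ω => {u : UnitData J 𝒳 | treat u = s}.indicator (1 : UnitData J 𝒳 → ℝ) (U i ω))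
    (by
      rw [← hlaw 0] at hI
      exact hI.comp_measurable (hU 0))
    (fun i j hij => (hind.indepFun hij).comp hf hf)
    (fun i => IdentDistrib.comp (f := U i) (g := U 0)
      ⟨(hU i).aemeasurable, (hU 0).aemeasurable, by rw [hlaw, hlaw]⟩ hf)
  have hE : ∫ ω, {u : UnitData J 𝒳 | treat u = s}.indicator (1 : UnitData J 𝒳 → ℝ) (U 0 ω) ∂P
      = Q.real {u | treat u = s} := by
    rw [← integral_map (hU 0).aemeasurable hf.aestronglyMeasurable, hlaw,
      integral_indicator_one (measurableSet_treat s)]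
  rw [hE] at h
  filter_upwards [h] with ω hω
  simpa only [hfe, groupSize] using hω

/-- The law of an infinite sample in which the unit `i` is drawn from the population of the units
with treatment `τ i`. -/
noncomputable abbrev sampleLaw (Q : Measure (UnitData J 𝒳)) (τ : ℕ → Fin 2) :
    Measure (ℕ → UnitData J 𝒳) :=
  Measure.infinitePi fun i => armLaw Q (τ i)

variable {Q : Measure (UnitData J 𝒳)} [∀ s, IsProbabilityMeasure (armLaw Q s)]

lemma isArmSample_sampleLaw (τ : ℕ → Fin 2) :
    IsArmSample (armLaw Q) τ (sampleLaw Q τ) (fun i v => v i) where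
  measurable := measurable_pi_apply
  indep := iIndepFun_infinitePi (X := fun _ => id) fun _ => measurable_id
  law i := Measure.infinitePi_map_eval _ i

lemma ae_sampleLaw_treat (τ : ℕ → Fin 2) : ∀ᵐ v ∂(sampleLaw Q τ), ∀ i, treat (v i) = τ i := by
  refine ae_all_iff.mpr fun i => ?_
  have h : ∀ᵐ u ∂(armLaw Q (τ i)), treat u = τ i := ae_cond_mem (measurableSet_treat (τ i))
  rw [← (isArmSample_sampleLaw (Q := Q) τ).law i] at h
  exact ae_of_ae_map (measurable_pi_apply i).aemeasurable h

variable {Ω : Type*} [MeasurableSpace Ω] {P : Measure Ω}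
  [IsProbabilityMeasure Q] {U : ℕ → Ω → UnitData J 𝒳}

/-- Given their treatments, the first `n` units are independent, each with the law of a unit with
its treatment. -/
lemma isProbabilityMeasure_condTreat_and_map_eq (hU : ∀ i, Measurable (U i))
    (hind : iIndepFun U P) (hlaw : ∀ i, P.map (U i) = Q) (τ : ℕ → Fin 2) (n : ℕ) :
    IsProbabilityMeasure (condTreat P U τ n) ∧
      (condTreat P U τ n).map (fun ω (i : Fin n) => U i ω)
        = Measure.pi fun i : Fin n => armLaw Q (τ i) := by
  set R : Ω → Fin n → UnitData J 𝒳 := fun ω i => U i ω with hR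
  have hRm : Measurable R := measurable_pi_lambda _ fun i => hU i
  set A : Fin n → Set (UnitData J 𝒳) := fun i => {u | treat u = τ i} with hA
  have hAm : ∀ i, MeasurableSet (A i) := fun i => measurableSet_treat _
  have hE : {ω | ∀ i < n, treat (U i ω) = τ i} = R ⁻¹' (Set.univ.pi A) := by
    ext ω
    simp only [Set.mem_preimage, Set.mem_pi, Set.mem_univ, true_implies]
    exact ⟨fun h i => h i i.2, fun h i hi => h ⟨i, hi⟩⟩
  have hPR : P.map R = Measure.pi fun _ : Fin n => Q := by
    have := (hind.precomp (Fin.val_injective (n := n))).map_fun_eq_pi_map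
      fun i : Fin n => (hU i).aemeasurable
    simp only [hlaw] at this
    exact this
  have hmap : (condTreat P U τ n).map R = Measure.pi fun i : Fin n => armLaw Q (τ i) := by
    rw [condTreat, hE, map_cond_preimage hRm (MeasurableSet.univ_pi hAm), hPR, cond_pi _ hAm]
  refine ⟨⟨?_⟩, hmap⟩
  have := congrArg (fun μ => μ Set.univ) hmap
  simpa [Measure.map_apply hRm MeasurableSet.univ] using this

/-- Given the treatments of the first `n` units, the estimator computed from these units has the
same law as for units that are drawn independently from the two arms. -/
lemma identDistrib_deltaHat (hU : ∀ i, Measurable (U i))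
    (hind : iIndepFun U P) (hlaw : ∀ i, P.map (U i) = Q) (τ : ℕ → Fin 2) (n : ℕ) (t : Fin 2) :
    IdentDistrib (fun ω => deltaHat (fun i => U i ω) n t) (fun v => deltaHat v n t)
      (condTreat P U τ n) (sampleLaw Q τ) := by
  have hS := isArmSample_sampleLaw (Q := Q) τ
  have hid : IdentDistrib (fun ω (i : Fin n) => U i ω) (fun v (i : Fin n) => v i)
      (condTreat P U τ n) (sampleLaw Q τ) := by
    refine ⟨(measurable_pi_lambda _ fun i : Fin n => hU i.val).aemeasurable,
      (measurable_pi_lambda _ fun i : Fin n => measurable_pi_apply i.val).aemeasurable, ?_⟩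
    rw [(isProbabilityMeasure_condTreat_and_map_eq hU hind hlaw τ n).2]
    have := (hS.indep.precomp (Fin.val_injective (n := n))).map_fun_eq_pi_map
      fun i : Fin n => (hS.measurable i).aemeasurable
    simp only [hS.law] at this
    exact this.symm
  -- the estimator is a function of the first `n` units, extended by a constant sequence
  obtain ⟨u0⟩ : Nonempty (UnitData J 𝒳) := Q.nonempty_of_neZero
  have hext : Measurable fun (w : Fin n → UnitData J 𝒳) (i : ℕ) =>
      if h : i < n then w ⟨i, h⟩ else u0 := by
    refine measurable_pi_lambda _ fun i => ?_
    by_cases h : i < n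
    · simpa only [h, dif_pos] using measurable_pi_apply (⟨i, h⟩ : Fin n)
    · simpa only [h, dif_neg, not_false_eq_true] using measurable_const
  have hF := hid.comp ((measurable_deltaHat n t).comp hext)
  have e : ∀ v : ℕ → UnitData J 𝒳,
      deltaHat (fun i => if h : i < n then v (⟨i, h⟩ : Fin n) else u0) n t = deltaHat v n t :=
    fun v => deltaHat_congr (fun i hi => by simp [hi]) t
  have h1 : (fun ω => deltaHat (fun i => U i ω) n t)
      = ((fun u => deltaHat u n t) ∘ fun (w : Fin n → UnitData J 𝒳) (i : ℕ) =>
        if h : i < n then w ⟨i, h⟩ else u0) ∘ fun ω (i : Fin n) => U i ω := by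
    ext ω
    exact (e fun i => U i ω).symm
  have h2 : (fun v : ℕ → UnitData J 𝒳 => deltaHat v n t)
      = ((fun u => deltaHat u n t) ∘ fun (w : Fin n → UnitData J 𝒳) (i : ℕ) =>
        if h : i < n then w ⟨i, h⟩ else u0) ∘ fun v (i : Fin n) => v i := by
    ext v
    exact (e v).symm
  rw [← h1, ← h2] at hF
  exact hF

end Transfer

end ConditionalLaw

/-! ### Asymptotics of the estimator, and the single stratum -/

section Asymptotics

variable {J : ℕ} {𝒳 : Type*}

lemma mediationEffect_eq_sum (t : Fin 2) (u : UnitData J 𝒳) :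
    mediationEffect t u = ∑ m, (potOut t m u * (if potMed 1 u = m then 1 else 0)
      - potOut t m u * (if potMed 0 u = m then 1 else 0)) := by
  simp [mediationEffect, Finset.sum_sub_distrib]

variable [MeasurableSpace 𝒳]

lemma estimand_eq (Q : Measure (UnitData J 𝒳)) (t : Fin 2) :
    estimand Q t = (if t = 1 then 1 else -1) *
      (∑ m, mu Q t m * nu Q t m - ∑ m, mu Q t m * nu Q (1 - t) m) := by
  rw [← Finset.sum_sub_distrib, Finset.mul_sum, estimand]
  refine Finset.sum_congr rfl fun m _ => ?_
  fin_cases t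
  · simp only [Fin.zero_eta, zero_ne_one, if_false, sub_zero]
    ring
  · simp only [Fin.mk_one, if_true, sub_self]
    ring

/-- The conclusions about the conditional distribution of the estimator, for units drawn
independently from the two arms. -/
lemma asymptotics_deltaHat_sampleLaw {Q : Measure (UnitData J 𝒳)}
    [IsProbabilityMeasure Q] [∀ s, IsProbabilityMeasure (armLaw Q s)] {t : Fin 2}
    (hY : MemLp obsOut 2 (armLaw Q t)) (hν : ∀ m, 0 < nu Q t m) {τ : ℕ → Fin 2} {q : Fin 2 → ℝ}
    (hq : ∀ s, 0 < q s)
    (hτ : ∀ s, Tendsto (fun n : ℕ => groupSize τ n s / n) atTop (𝓝 (q s))) :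
    (∀ n, MemLp (fun v => deltaHat v n t) 2 (sampleLaw Q τ)) ∧
    Tendsto (fun n : ℕ => (n : ℝ) * variance (fun v => deltaHat v n t) (sampleLaw Q τ)) atTop
      (𝓝 (varFormula Q t (q t) (q (1 - t)))) ∧
    TendstoInDistribution (fun (n : ℕ) v => √(n : ℝ) * (deltaHat v n t - estimand Q t))
      atTop id (fun _ => sampleLaw Q τ)
      (gaussianReal 0 (varFormula Q t (q t) (q (1 - t))).toNNReal) := by
  have H := isArmSample_sampleLaw (Q := Q) τ
  set e : ℝ := if t = 1 then 1 else -1 with he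
  have he2 : e ^ 2 = 1 := by rw [he]; split_ifs <;> norm_num
  have hts : t ≠ 1 - t := by fin_cases t <;> decide
  have hφm : Measurable (influenceSelf Q t) :=
    measurable_cellwiseAffine measurable_obsMed measurable_obsOut
  have hψm : Measurable (influenceOther Q t) :=
    measurable_cellwiseAffine measurable_obsMed measurable_const
  have hφL : MemLp (influenceSelf Q t) 2 (armLaw Q t) := memLp_cellwiseAffine measurable_obsMed hY
  have hψL : MemLp (influenceOther Q t) 2 (armLaw Q (1 - t)) :=
    memLp_cellwiseAffine measurable_obsMed (memLp_const 0)
  have hae : ∀ n, (fun v => deltaHat v n t) =ᵐ[sampleLaw Q τ] fun v => e *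
      ∑ m, cellEst τ (fun i v => v i) t (1 - t) obsMed obsOut m n v := fun n => by
    filter_upwards [ae_sampleLaw_treat (Q := Q) τ] with v hv
    exact deltaHat_eq_sum_cellEst hv n t
  have hmem : ∀ n, MemLp (fun v => deltaHat v n t) 2 (sampleLaw Q τ) := fun n =>
    ((memLp_finsetSum Finset.univ fun m _ => H.memLp_cellEst (s := 1 - t) measurable_obsMed
      measurable_obsOut hY m n).const_mul e).ae_eq (hae n).symm
  have hrem := H.tendsto_mul_integral_sq_sum_cellEst_sub (t := t) (s := 1 - t)
    (a := mu Q t) (σ2 := cellVar Q t) (r := fun m => nu Q (1 - t) m / nu Q t m)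
    measurable_obsMed measurable_obsOut hY
    (fun m => variance_nonneg _ _) (fun m => div_nonneg measureReal_nonneg (hν m).le) hν
    (fun m => div_mul_cancel₀ _ (hν m).ne') (fun m => integral_cellRes_mu hY (hν m))
    (fun m => integral_sq_cellRes_mu (hν m)) (hq t) (hq (1 - t)) (hτ t) (hτ (1 - t))
  have hrem' : Tendsto (fun n : ℕ => (n : ℝ) * ∫ v, (deltaHat v n t
      - (armAvg τ (fun i v => v i) t (fun u => e * influenceSelf Q t u) n v
        + armAvg τ (fun i v => v i) (1 - t) (fun u => -e * influenceOther Q t u) n v)) ^ 2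
      ∂(sampleLaw Q τ)) atTop (𝓝 0) := by
    refine hrem.congr fun n => ?_
    congr 1
    refine integral_congr_ae ?_
    filter_upwards [hae n] with v hv
    rw [hv, armAvg_const_mul, armAvg_const_mul]
    change _ = (e * _ - (e * armAvg τ _ t (cellwiseAffine _ _ _ _ _) n v
      + -e * armAvg τ _ (1 - t) (cellwiseAffine _ _ _ _ _) n v)) ^ 2
    rw [← one_mul ((_ - _ : ℝ) ^ 2), ← he2]
    ring
  have hvar : variance (fun u => e * influenceSelf Q t u) (armLaw Q t) / q t
      + variance (fun u => -e * influenceOther Q t u) (armLaw Q (1 - t)) / q (1 - t)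
      = varFormula Q t (q t) (q (1 - t)) := by
    rw [variance_const_mul, variance_const_mul, neg_sq, he2, one_mul, one_mul,
      varFormula_eq hY hν (hq t).ne']
  have hmean : ∫ u, e * influenceSelf Q t u ∂(armLaw Q t)
      + ∫ u, -e * influenceOther Q t u ∂(armLaw Q (1 - t)) = estimand Q t := by
    rw [integral_const_mul, integral_const_mul, integral_influenceSelf hY hν,
      integral_influenceOther, estimand_eq]
    ring
  refine ⟨hmem, ?_, ?_⟩
  · rw [← hvar]
    exact H.tendsto_mul_variance hts (hφm.const_mul e) (hψm.const_mul (-e)) (hφL.const_mul e)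
      (hψL.const_mul (-e)) (hq t) (hq (1 - t)) (hτ t) (hτ (1 - t)) hmem hrem'
  · have := H.tendstoInDistribution_of_remainder hts (hφm.const_mul e) (hψm.const_mul (-e))
      (hφL.const_mul e) (hψL.const_mul (-e)) (hq t) (hq (1 - t)) (hτ t) (hτ (1 - t)) hmem hrem'
    rw [hmean] at this
    simpa only [hvar] using this

/-- The variance formula at the group sizes, times `n`, converges to its value at the limiting
proportions. -/
lemma tendsto_mul_varFormula {Q : Measure (UnitData J 𝒳)}
    [IsProbabilityMeasure Q] [∀ s, IsProbabilityMeasure (armLaw Q s)] {t : Fin 2}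
    (hY : MemLp obsOut 2 (armLaw Q t)) (hν : ∀ m, 0 < nu Q t m) {τ : ℕ → Fin 2} {q : Fin 2 → ℝ}
    (hq : ∀ s, 0 < q s)
    (hτ : ∀ s, Tendsto (fun n : ℕ => groupSize τ n s / n) atTop (𝓝 (q s))) :
    Tendsto (fun n : ℕ => (n : ℝ) * varFormula Q t (groupSize τ n t) (groupSize τ n (1 - t))) atTop
      (𝓝 (varFormula Q t (q t) (q (1 - t)))) := by
  rw [varFormula_eq hY hν (hq t).ne']
  have h := ((tendsto_div_groupSize (hq t) (hτ t)).const_mul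
    (variance (influenceSelf Q t) (armLaw Q t))).add
    ((tendsto_div_groupSize (hq (1 - t)) (hτ (1 - t))).const_mul
      (variance (influenceOther Q t) (armLaw Q (1 - t))))
  rw [mul_one_div, mul_one_div] at h
  refine h.congr' ?_
  filter_upwards [(tendsto_groupSize_atTop (hq t) (hτ t)).eventually_gt_atTop 0] with n hn
  rw [varFormula_eq hY hν hn.ne']
  ring

section Stratum

/-- If the covariates are almost surely constant, conditioning on them has no effect. -/
lemma condProb_ae_eq_of_covar_const {μ : Measure (UnitData J 𝒳)} [IsProbabilityMeasure μ] {x : 𝒳}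
    (hx : ∀ᵐ u ∂μ, covar u = x) {A : Set (UnitData J 𝒳)} (hA : MeasurableSet A) :
    μ⟦A|covarSigma J 𝒳⟧ =ᵐ[μ] fun _ => μ.real A := by
  have hint : Integrable (A.indicator fun _ => (1 : ℝ)) μ := (integrable_const 1).indicator hA
  refine (ae_eq_condExp_of_forall_setIntegral_eq covarSigma_le hint
    (fun s _ _ => (integrable_const _).integrableOn) (fun s hs _ => ?_)
    stronglyMeasurable_const.aestronglyMeasurable).symm
  obtain ⟨B, -, rfl⟩ := hs
  by_cases hxB : x ∈ B
  · have hu : covar ⁻¹' B =ᵐ[μ] (Set.univ : Set (UnitData J 𝒳)) := by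
      filter_upwards [hx] with u hu
      change (covar u ∈ B) = True
      simp [hu, hxB]
    rw [setIntegral_congr_set hu, setIntegral_congr_set hu, setIntegral_univ, setIntegral_univ,
      show (A.indicator fun _ => (1 : ℝ)) = A.indicator 1 from rfl, integral_indicator_one hA]
    simp
  · have hu : covar ⁻¹' B =ᵐ[μ] (∅ : Set (UnitData J 𝒳)) := by
      filter_upwards [hx] with u hu
      change (covar u ∈ B) = False
      simp [hu, hxB]
    rw [setIntegral_congr_set hu, setIntegral_congr_set hu, setIntegral_empty, setIntegral_empty]

variable [StandardBorelSpace 𝒳]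

lemma indepFun_of_condIndepFun {μ : Measure (UnitData J 𝒳)} [IsProbabilityMeasure μ] {x : 𝒳}
    (hx : ∀ᵐ u ∂μ, covar u = x) {α β : Type*} [MeasurableSpace α] [MeasurableSpace β]
    {f : UnitData J 𝒳 → α} {g : UnitData J 𝒳 → β} (hf : Measurable f) (hg : Measurable g)
    (h : CondIndepFun (covarSigma J 𝒳) covarSigma_le f g μ) : IndepFun f g μ := by
  rw [indepFun_iff_measure_inter_preimage_eq_mul]
  intro A B hA hB
  have h1 := (condIndepFun_iff _ _ f g hf hg μ).mp h _ _ ⟨A, hA, rfl⟩ ⟨B, hB, rfl⟩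
  have h2 := condProb_ae_eq_of_covar_const hx ((hf hA).inter (hg hB))
  have h3 := condProb_ae_eq_of_covar_const hx (hf hA)
  have h4 := condProb_ae_eq_of_covar_const hx (hg hB)
  obtain ⟨u, h1, h2, h3, h4⟩ := (h1.and (h2.and (h3.and h4))).exists
  rw [h2, Pi.mul_apply, h3, h4] at h1
  rw [← ENNReal.toReal_eq_toReal_iff' (measure_ne_top _ _)
    (ENNReal.mul_ne_top (measure_ne_top _ _) (measure_ne_top _ _)), ENNReal.toReal_mul]
  exact h1

/-- Conditioning on an event of an independent variable does not change the law. -/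
lemma identDistrib_cond_of_indepFun {Ω α β : Type*} [MeasurableSpace Ω] [MeasurableSpace α]
    [MeasurableSpace β] [MeasurableSingletonClass β] {μ : Measure Ω} [IsFiniteMeasure μ]
    {f : Ω → α} {g : Ω → β} (hf : Measurable f) (hg : Measurable g) (h : IndepFun f g μ) {b : β}
    (hb : μ {ω | g ω = b} ≠ 0) : IdentDistrib f f (cond μ {ω | g ω = b}) μ := by
  refine ⟨hf.aemeasurable, hf.aemeasurable, ?_⟩
  ext A hA
  have hm : MeasurableSet {ω | g ω = b} := hg (measurableSet_singleton b)
  rw [Measure.map_apply hf hA, Measure.map_apply hf hA, cond_apply hm, Set.inter_comm]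
  have := (indepFun_iff_measure_inter_preimage_eq_mul.mp h) A {b} hA (measurableSet_singleton b)
  change μ (f ⁻¹' A ∩ {ω | g ω = b}) = μ (f ⁻¹' A) * μ {ω | g ω = b} at this
  rw [this, mul_comm, mul_assoc, ENNReal.mul_inv_cancel hb (measure_ne_top _ _), mul_one]

variable {Q : Measure (UnitData J 𝒳)} [IsProbabilityMeasure Q] {t : Fin 2}

/-- Within one covariate stratum, `Y(t, m)` has mean `μ_{tm}` in either arm. It is integrable,
because it coincides with the observed outcome on the event `T = t`, `M(t) = m`, which has positive
probability, and because given `T = t` it is independent of `M(t)`. -/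
lemma SequentialIgnorability.integrable_potOut_and_integral_eq (hQ : SequentialIgnorability Q)
    (hY : MemLp obsOut 2 Q) {x : 𝒳} (hx : ∀ᵐ u ∂Q, covar u = x) (m : Fin J) (s : Fin 2) :
    Integrable (potOut t m) (armLaw Q s) ∧ ∫ u, potOut t m u ∂(armLaw Q s) = mu Q t m := by
  have := hQ.isProbabilityMeasure_armLaw t
  have hxt : ∀ᵐ u ∂(armLaw Q t), covar u = x := cond_absolutelyContinuous.ae_le hx
  have hYm := measurable_potOut (𝒳 := 𝒳) t m
  have hν := hQ.nu_pos t m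
  have hYt := memLp_obsOut_armLaw hY t (hQ.measure_treat_ne_zero t)
  -- under any arm, `Y(t, m)` has the same law as in the whole population
  have hid : ∀ r, IdentDistrib (potOut t m) (potOut t m) (armLaw Q r) Q := fun r =>
    identDistrib_cond_of_indepFun hYm measurable_treat
      ((indepFun_of_condIndepFun hx (hYm.prodMk (measurable_potMed t)) measurable_treat
        (hQ.treatment t t m)).comp measurable_fst measurable_id) (hQ.measure_treat_ne_zero r)
  have hst : IdentDistrib (potOut t m) (potOut t m) (armLaw Q s) (armLaw Q t) :=
    (hid s).trans (hid t).symm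
  have hmed : IndepFun (potOut t m) (potMed t) (armLaw Q t) :=
    indepFun_of_condIndepFun hxt hYm (measurable_potMed t) (hQ.mediator t t m)
  have hIm : Measurable fun k : Fin J => if k = m then (1 : ℝ) else 0 := measurable_of_finite _
  have hI := hmed.comp measurable_id hIm
  -- on the cell `M = m` of arm `t`, the outcome is `Y(t, m)`
  have hae : (fun u => potOut t m u * (if potMed t u = m then 1 else 0))
      =ᵐ[armLaw Q t] {u : UnitData J 𝒳 | obsMed u = m}.indicator obsOut := by
    filter_upwards [ae_cond_mem (μ := Q) (measurableSet_treat t)] with u hu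
    have hu' : treat u = t := hu
    by_cases h : potMed t u = m <;> simp [obsMed, obsOut, hu', h]
  have hprod : Integrable (fun u => potOut t m u * (if potMed t u = m then 1 else 0))
      (armLaw Q t) :=
    ((hYt.integrable one_le_two).indicator (measurableSet_obsMed m)).congr hae.symm
  have hIint : ∫ u, (if potMed t u = m then (1 : ℝ) else 0) ∂(armLaw Q t) = nu Q t m := by
    rw [nu_eq, ← integral_cellInd (measurable_potMed t)]
    rfl
  have hne : ¬ (fun u => if potMed t u = m then (1 : ℝ) else 0) =ᵐ[armLaw Q t] 0 := fun h0 => by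
    rw [integral_congr_ae h0] at hIint
    simp only [Pi.zero_apply, integral_zero] at hIint
    exact hν.ne hIint
  have hint : Integrable (potOut t m) (armLaw Q t) :=
    IndepFun.integrable_left_of_integrable_op (B := fun a b : ℝ => a * b) hI 1 one_ne_zero
      (by simp) hprod hYm.aestronglyMeasurable
      (hIm.comp (measurable_potMed t)).aestronglyMeasurable hne
  refine ⟨hst.integrable_iff.mpr hint, ?_⟩
  have hmul : ∫ u, potOut t m u * (if potMed t u = m then 1 else 0) ∂(armLaw Q t)
      = (∫ u, potOut t m u ∂(armLaw Q t)) * nu Q t m := by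
    rw [← hIint]
    exact hI.integral_mul_eq_mul_integral hYm.aestronglyMeasurable
      (hIm.comp (measurable_potMed t)).aestronglyMeasurable
  have hcell : ∫ u, potOut t m u * (if potMed t u = m then 1 else 0) ∂(armLaw Q t)
      = mu Q t m * nu Q t m := by
    have h0 := integral_cellRes_mu hYt hν
    have hd : cellRes obsMed obsOut m (mu Q t m)
        = fun u : UnitData J 𝒳 => {u : UnitData J 𝒳 | obsMed u = m}.indicator obsOut u
          - mu Q t m * cellInd obsMed m u := by
      ext u
      by_cases h : obsMed u = m <;> simp [cellRes, cellInd, h]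
    rw [hd, integral_sub ((hYt.integrable one_le_two).indicator (measurableSet_obsMed m))
      (((memLp_cellInd measurable_obsMed m _).integrable one_le_two).const_mul _),
      integral_const_mul, integral_cellInd measurable_obsMed] at h0
    rw [integral_congr_ae hae]
    exact sub_eq_zero.mp h0
  rw [hst.integral_eq]
  exact mul_right_cancel₀ hν.ne' (hmul.symm.trans hcell)

/-- Within one covariate stratum, the contribution of the cell `m` to the mean of `Y(t, M(r))`. -/
lemma SequentialIgnorability.integrable_potOut_mul_and_integral_eq
    (hQ : SequentialIgnorability Q) (hY : MemLp obsOut 2 Q) {x : 𝒳}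
    (hx : ∀ᵐ u ∂Q, covar u = x) (m : Fin J) (r : Fin 2) :
    Integrable (fun u => potOut t m u * (if potMed r u = m then 1 else 0)) Q ∧
      ∫ u, potOut t m u * (if potMed r u = m then 1 else 0) ∂Q = mu Q t m * nu Q r m := by
  have := hQ.isProbabilityMeasure_armLaw r
  have hxr : ∀ᵐ u ∂(armLaw Q r), covar u = x := cond_absolutelyContinuous.ae_le hx
  have hYm := measurable_potOut (𝒳 := 𝒳) t m
  have hMm := measurable_potMed (J := J) (𝒳 := 𝒳) r
  have hIm : Measurable fun k : Fin J => if k = m then (1 : ℝ) else 0 := measurable_of_finite _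
  obtain ⟨hint, hmean⟩ := hQ.integrable_potOut_and_integral_eq (t := t) hY hx m r
  -- ignorability of `M(r)` is available in the arm `T = r` only, so the factorization takes place
  -- there
  have hI := (indepFun_of_condIndepFun hxr hYm hMm (hQ.mediator r t m)).comp measurable_id hIm
  have hid : IdentDistrib (fun u => potOut t m u * (if potMed r u = m then 1 else 0))
      (fun u => potOut t m u * (if potMed r u = m then 1 else 0)) (armLaw Q r) Q :=
    (identDistrib_cond_of_indepFun (hYm.prodMk hMm) measurable_treat
      (indepFun_of_condIndepFun hx (hYm.prodMk hMm) measurable_treat (hQ.treatment r t m))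
      (hQ.measure_treat_ne_zero r)).comp
      (u := fun p : ℝ × Fin J => p.1 * (if p.2 = m then 1 else 0))
      (measurable_fst.mul (hIm.comp measurable_snd))
  have hIint : ∫ u, (if potMed r u = m then (1 : ℝ) else 0) ∂(armLaw Q r) = nu Q r m := by
    rw [nu_eq, ← integral_cellInd hMm]
    rfl
  have hIi : Integrable (fun u => if potMed r u = m then (1 : ℝ) else 0) (armLaw Q r) :=
    (memLp_cellInd hMm m _).integrable one_le_two
  refine ⟨hid.integrable_iff.mp (hI.integrable_mul hint hIi), ?_⟩
  rw [← hid.integral_eq, ← hmean, ← hIint]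
  exact hI.integral_mul_eq_mul_integral hYm.aestronglyMeasurable
    (hIm.comp hMm).aestronglyMeasurable

lemma SequentialIgnorability.integrable_mediationEffect_and_estimand_eq
    (hQ : SequentialIgnorability Q) (hY : MemLp obsOut 2 Q) {x : 𝒳}
    (hx : ∀ᵐ u ∂Q, covar u = x) :
    Integrable (mediationEffect t) Q ∧ estimand Q t = ∫ u, mediationEffect t u ∂Q := by
  have h := fun m r => hQ.integrable_potOut_mul_and_integral_eq (t := t) hY hx m r
  have he : mediationEffect t = fun u : UnitData J 𝒳 => _ := funext (mediationEffect_eq_sum t)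
  have hi := fun m => (h m 1).1.sub (h m 0).1
  rw [he]
  refine ⟨integrable_finsetSum _ fun m _ => hi m, ?_⟩
  rw [integral_finsetSum (f := fun m u => potOut t m u * (if potMed 1 u = m then 1 else 0)
    - potOut t m u * (if potMed 0 u = m then 1 else 0)) _ fun m _ => hi m, estimand]
  refine Finset.sum_congr rfl fun m _ => ?_
  rw [mul_sub, ← (h m 1).2, ← (h m 0).2]
  exact (integral_sub (h m 1).1 (h m 0).1).symm

end Stratum

end Asymptotics

end Mediation

open Mediation in
theorem theorem3 {J : ℕ} {𝒳 : Type*} [MeasurableSpace 𝒳] [StandardBorelSpace 𝒳]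
    -- the population law of one unit
    (Q : Measure (UnitData J 𝒳)) [IsProbabilityMeasure Q]
    (hQ : SequentialIgnorability Q)
    (hY : MemLp obsOut 2 Q)
    -- a simple random sample from it
    {Ω : Type*} [MeasurableSpace Ω] (P : Measure Ω) [IsProbabilityMeasure P]
    (U : ℕ → Ω → UnitData J 𝒳) (hU : ∀ i, Measurable (U i))
    (hind : iIndepFun U P) (hlaw : ∀ i, P.map (U i) = Q)
    (t : Fin 2) :
    -- almost every realized treatment sequence has limiting group proportions in `(0, 1)`
    (∀ s : Fin 2, 0 < Q.real {u | treat u = s}) ∧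
    (∀ᵐ ω ∂P, ∀ s : Fin 2, Tendsto
      (fun n : ℕ => groupSize (fun i => treat (U i ω)) n s / n) atTop
      (𝓝 (Q.real {u | treat u = s}))) ∧
    -- given any treatment sequence with limiting group proportions in `(0, 1)`
    (∀ (τ : ℕ → Fin 2) (q : Fin 2 → ℝ), (∀ s, 0 < q s) →
      (∀ s, Tendsto (fun n : ℕ => groupSize τ n s / n) atTop (𝓝 (q s))) →
      (∀ n, IsProbabilityMeasure (condTreat P U τ n)) ∧
      (∀ n, MemLp (fun ω => deltaHat (fun i => U i ω) n t) 2 (condTreat P U τ n)) ∧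
      -- the conditional variance agrees with the formula up to `o(1 / n)`
      Tendsto (fun n : ℕ => (n : ℝ) *
          (variance (fun ω => deltaHat (fun i => U i ω) n t) (condTreat P U τ n)
            - varFormula Q t (groupSize τ n t) (groupSize τ n (1 - t)))) atTop (𝓝 0) ∧
      -- the formula times `n` converges to the variance of the limiting normal law
      0 ≤ varFormula Q t (q t) (q (1 - t)) ∧
      Tendsto (fun n : ℕ => (n : ℝ) *
          varFormula Q t (groupSize τ n t) (groupSize τ n (1 - t))) atTop
        (𝓝 (varFormula Q t (q t) (q (1 - t)))) ∧
      (0 < varFormula Q t (q t) (q (1 - t)) →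
        Tendsto (fun n : ℕ =>
          variance (fun ω => deltaHat (fun i => U i ω) n t) (condTreat P U τ n)
            / varFormula Q t (groupSize τ n t) (groupSize τ n (1 - t))) atTop (𝓝 1)) ∧
      (∀ f : BoundedContinuousFunction ℝ ℝ, Tendsto (fun n : ℕ =>
          ∫ ω, f (√(n : ℝ) * (deltaHat (fun i => U i ω) n t - estimand Q t))
            ∂(condTreat P U τ n)) atTop
        (𝓝 (∫ z, f z ∂(gaussianReal 0 (varFormula Q t (q t) (q (1 - t))).toNNReal))))) ∧
    -- within one covariate stratum, the centre is the average causal mediation effect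
    ((∃ x : 𝒳, ∀ᵐ u ∂Q, covar u = x) →
      Integrable (mediationEffect t) Q ∧ estimand Q t = ∫ u, mediationEffect t u ∂Q) := by
  have hprob := hQ.isProbabilityMeasure_armLaw
  have hν := hQ.nu_pos t
  have hYt := memLp_obsOut_armLaw hY t (hQ.measure_treat_ne_zero t)
  refine ⟨hQ.treat_pos, ae_tendsto_groupSize hU hind hlaw, fun τ q hq hτ => ?_,
    fun ⟨x, hx⟩ => hQ.integrable_mediationEffect_and_estimand_eq hY hx⟩
  obtain ⟨hmem, hvar, hdist⟩ := asymptotics_deltaHat_sampleLaw hYt hν hq hτ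
  have hform := tendsto_mul_varFormula hYt hν hq hτ
  have hid := fun n => identDistrib_deltaHat hU hind hlaw τ n t
  have hvar' : Tendsto (fun n : ℕ => (n : ℝ) *
      variance (fun ω => deltaHat (fun i => U i ω) n t) (condTreat P U τ n)) atTop
      (𝓝 (varFormula Q t (q t) (q (1 - t)))) := by
    refine hvar.congr fun n => ?_
    rw [(hid n).variance_eq]
  refine ⟨fun n => (isProbabilityMeasure_condTreat_and_map_eq hU hind hlaw τ n).1,
    fun n => (hid n).memLp_iff.mpr (hmem n), ?_, ?_, hform, fun hpos => ?_, fun f => ?_⟩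
  · have := hvar'.sub hform
    rw [sub_self] at this
    exact this.congr fun n => (mul_sub _ _ _).symm
  · rw [varFormula_eq hYt hν (hq t).ne']
    exact add_nonneg (div_nonneg (variance_nonneg _ _) (hq t).le)
      (div_nonneg (variance_nonneg _ _) (hq (1 - t)).le)
  · have := hvar'.div hform hpos.ne'
    rw [div_self hpos.ne'] at this
    refine this.congr' ?_
    filter_upwards [eventually_gt_atTop 0] with n hn
    exact mul_div_mul_left _ _ (Nat.cast_ne_zero.mpr hn.ne')
  · have := (ProbabilityMeasure.tendsto_iff_forall_integral_tendsto.mp hdist.tendsto) f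
    simp only [ProbabilityMeasure.coe_mk, Measure.map_id] at this
    refine this.congr fun n => ?_
    rw [integral_map (hdist.forall_aemeasurable n) f.continuous.aestronglyMeasurable]
    exact (((hid n).comp (u := fun x => f (√(n : ℝ) * (x - estimand Q t)))
      (by fun_prop)).integral_eq).symm
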